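/- Let $\{F_\theta:\theta\in\Theta\}$ be a family of distributions on $\mathbb{R}$ with continuous cdfs, and let $x_1,x_2,\ldots$ be i.i.d. from a distribution $P_{true}$ on $\mathbb{R}$. Write $\mathcal H_0$ for the hypothesis $P_{true}\in\{F_\theta:\theta\in\Theta\}$. Let $\theta_0\in\Theta$ be such that $P_{true}=F_{\theta_0}$ whenever $\mathcal H_0$ is true (as is the case for a minimizer over $\theta$ of any divergence between $P_{true}$ and $F_\theta$ that vanishes only when they are equal). Let $\theta(x)=\theta(x_1,\ldots,x_n)$ be an estimator with $\sup_z|F_{\theta(x)}(z)-F_{\theta_0}(z)|\to0$ a.s. as $n\to\infty$. (The same symbol is used for a distribution and its cdf.) For distributions $P,G$ on $\mathbb{R}$ put $d_{CvM}(P,G)=\int(P(z)-G(z))^2\,G(dz)$. Fix $a>0$ and integers $1\le i_0<M$. For a probability measure $H$, $P\sim DP(a,H)$ means that $P$ is a random probability measure such that, for every finite measurable partition $A_1,\ldots,A_k$ of $\mathbb R$, $(P(A_1),\ldots,P(A_k))$ has the Dirichlet distribution with parameters $(aH(A_1),\ldots,aH(A_k))$, a coordinate whose parameter is $0$ being a.s.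 $0$. Consider $D(P)=d_{CvM}(P,F_{\theta(x)})$. A priori, $P\sim DP(a,F_{\theta(x)})$; write $DP_D$ for the resulting prior distribution of $D$ and $d_p=\inf\{t: DP_D((-\infty,t])\ge p\}$ for its $p$-quantile. (As the $F_\theta$ are continuous, $DP_D$ and $d_p$ are the same whatever the value of $\theta(x)$; below, in the limit in (i) and in the condition in (ii), they are taken at $\theta_0$.) A posteriori, $P\sim DP(a+n,H_x)$ with $H_x=\frac{a}{a+n}F_{\theta(x)}+\frac{n}{a+n}F_n$, where $F_n$ is the empirical distribution of $x_1,\ldots,x_n$; write $DP_D(\cdot\,|\,x)$ for the resulting posterior distribution of $D$. Consider the discretization of the range of $D$ into the cells $$[0,d_{i_0/M}),\ [d_{i_0/M},d_{(i_0+1)/M}),\ \ldots,\ [d_{(M-1)/M},\infty).$$ The relative belief ratio of a cell $C$ is $RB_D(C\,|\,x)=DP_D(C\,|\,x)/DP_D(C)$. For $d\ge0$ let $RB_D(d\,|\,x)$ be the relative belief ratio of the cell containing $d$, and let the strength be $DP_D(RB_D(d\,|\,x)\le RB_D(0\,|\,x)\,|\,x)$, the posterior probability that the cell containing $D$ has a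 relative belief ratio no greater than that of $[0,d_{i_0/M})$. Then, as $n\to\infty$: (i) if $\mathcal H_0$ is true, then $DP_D([0,d_{i_0/M}))>0$ and $$RB_D([0,d_{i_0/M})\,|\,x)\overset{a.s.}{\rightarrow}\frac1{DP_D([0,d_{i_0/M}))};$$ for each $i$ with $i_0\le i\le M-1$, $RB_D([d_{i/M},d_{(i+1)/M})\,|\,x)\overset{a.s.}{\rightarrow}0$ (the cell for $i=M-1$ being $[d_{(M-1)/M},\infty)$); and $DP_D(RB_D(d\,|\,x)\le RB_D(0\,|\,x)\,|\,x)\overset{a.s.}{\rightarrow}1$; (ii) if $\mathcal H_0$ is false and $d_{CvM}(P_{true},F_{\theta_0})>d_{i_0/M}$, then $RB_D([0,d_{i_0/M})\,|\,x)\overset{a.s.}{\rightarrow}0$ and $DP_D(RB_D(d\,|\,x)\le RB_D(0\,|\,x)\,|\,x)\overset{a.s.}{\rightarrow}0$. -/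

import Mathlib

open MeasureTheory ProbabilityTheory Filter Set
open scoped Topology

namespace ModelCheck

/-! ### The Dirichlet process -/

/-- The gamma distribution with shape `α` and rate `1`; for shape `0` it is the unit mass at `0`. -/
noncomputable def gammaOne (α : ℝ) : Measure ℝ :=
  if α = 0 then Measure.dirac 0 else gammaMeasure α 1

/-- The Dirichlet distribution with parameters `α₁, …, αₖ ≥ 0`, not all zero: the law of
`(Z₁ / ∑ Zⱼ, …, Zₖ / ∑ Zⱼ)` for independent `Zᵢ ~ gamma(αᵢ, 1)`. A coordinate whose parameter
vanishes is almost surely `0`. -/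
noncomputable def dirichlet {k : ℕ} (α : Fin k → ℝ) : Measure (Fin k → ℝ) :=
  (Measure.pi fun i => gammaOne (α i)).map fun z i => z i / ∑ j, z j

/-- `law` is the law of a Dirichlet process `P ~ DP(a, H)` on `ℝ`: a law on the probability
measures on `ℝ` (with the σ-algebra generated by the evaluations `P ↦ P A`) such that, for every
finite measurable partition `A₁, …, Aₖ` of `ℝ`, the vector `(P A₁, …, P Aₖ)` has the Dirichlet
distribution with parameters `a H(A₁), …, a H(Aₖ)`. -/
def IsDirichletProcess (a : ℝ) (H : Measure ℝ) (law : Measure (ProbabilityMeasure ℝ)) : Prop :=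
  ∀ (k : ℕ) (A : Fin k → Set ℝ), (∀ i, MeasurableSet (A i)) →
    Pairwise (fun i j => Disjoint (A i) (A j)) → (⋃ i, A i) = univ →
      law.map (fun (P : ProbabilityMeasure ℝ) i => (P : Measure ℝ).real (A i)) = dirichlet fun i => a * H.real (A i)

/-- The empirical distribution `Fₙ = n⁻¹ ∑ δ_{xᵢ}` of a sample. -/
noncomputable def empirical {n : ℕ} (x : Fin n → ℝ) : Measure ℝ :=
  (n : ENNReal)⁻¹ • ∑ i, Measure.dirac (x i)

/-- The posterior base measure `H_x = a / (a + n) H + n / (a + n) Fₙ`. -/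
noncomputable def posteriorBase (a : ℝ) (H : Measure ℝ) {n : ℕ} (x : Fin n → ℝ) : Measure ℝ :=
  ENNReal.ofReal (a / (a + n)) • H + ENNReal.ofReal (n / (a + n)) • empirical x

/-! ### The Cramér–von Mises distance and the discretization of its range -/

/-- `d_CvM(P, G) = ∫ (P(x) - G(x))² G(dx)`, with `P` and `G` identified with their cdfs. -/
noncomputable def cvm (P G : Measure ℝ) : ℝ :=
  ∫ x, (cdf P x - cdf G x) ^ 2 ∂G

/-- The probability that `D(P) = d_CvM(P, G)` lies in `C`, when `P` is distributed as `law`. -/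
noncomputable def probD (law : Measure (ProbabilityMeasure ℝ)) (G : ProbabilityMeasure ℝ)
    (C : Set ℝ) : ℝ :=
  law.real {P : ProbabilityMeasure ℝ | cvm (P : Measure ℝ) (G : Measure ℝ) ∈ C}

/-- The `q`-th quantile `inf {t : q ≤ Pr(D ≤ t)}` of the distribution of `D(P) = d_CvM(P, G)`,
when `P` is distributed as `law`. -/
noncomputable def quantileD (law : Measure (ProbabilityMeasure ℝ)) (G : ProbabilityMeasure ℝ)
    (q : ℝ) : ℝ :=
  sInf {t : ℝ | q ≤ probD law G (Iic t)}

/-- The cell `[0, d_{i₀/M})` that stands for the hypothesis `D = 0`; the quantiles are those of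
the prior distribution of `D`. -/
noncomputable def nullCell (prior : Measure (ProbabilityMeasure ℝ)) (G : ProbabilityMeasure ℝ)
    (M i₀ : ℕ) : Set ℝ :=
  Ico 0 (quantileD prior G (i₀ / M))

/-- The other cells of the discretization: `[d_{i/M}, d_{(i+1)/M})` for `i < M - 1`, and
`[d_{(M-1)/M}, ∞)` for `i = M - 1`. -/
noncomputable def cell (prior : Measure (ProbabilityMeasure ℝ)) (G : ProbabilityMeasure ℝ)
    (M i : ℕ) : Set ℝ :=
  if i + 1 < M then
    Ico (quantileD prior G (i / M)) (quantileD prior G ((i + 1 : ℕ) / M))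
  else Ici (quantileD prior G (i / M))

/-- The discretization `{[0, d_{i₀/M}), [d_{i₀/M}, d_{(i₀+1)/M}), …, [d_{(M-1)/M}, ∞)}`. -/
noncomputable def cells (prior : Measure (ProbabilityMeasure ℝ)) (G : ProbabilityMeasure ℝ)
    (M i₀ : ℕ) : Set (Set ℝ) :=
  insert (nullCell prior G M i₀) (cell prior G M '' Ico i₀ M)

/-! ### Relative belief -/

/-- The relative belief ratio `RB_D(C | x)`: the ratio of the posterior to the prior probability
that `D(P) = d_CvM(P, G)` lies in `C`. -/
noncomputable def relBelief (prior post : Measure (ProbabilityMeasure ℝ))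
    (G : ProbabilityMeasure ℝ) (C : Set ℝ) : ℝ :=
  probD post G C / probD prior G C

/-- The strength `DP_D(RB_D(d | x) ≤ RB_D(0 | x) | x)`: the posterior probability that the cell
containing `D(P)` has a relative belief ratio no greater than that of `[0, d_{i₀/M})`. -/
noncomputable def strength (prior post : Measure (ProbabilityMeasure ℝ))
    (G : ProbabilityMeasure ℝ) (M i₀ : ℕ) : ℝ :=
  probD post G {d | ∃ C ∈ cells prior G M i₀, d ∈ C ∧
    relBelief prior post G C ≤ relBelief prior post G (nullCell prior G M i₀)}

end ModelCheck

namespace ModelCheck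

/-! ### Gamma and Dirichlet distributions -/

/-! The posterior of `D` concentrates at the single value `d* = d_CvM(P_true, F_θ₀)`, while the
prior law of `D` is fixed. So the posterior mass of any set of distances bounded away from `d*`
vanishes, and every relative belief ratio is such a mass divided by a constant.

Everything rests on one approximation. For a continuous `G` with `m`-quantile half-lines `E j`, the
distance `d_CvM(P, G)` differs from the Riemann sum of `(P(E j) - j/m)²` by at most `4/m`, uniformly
in `P` (`abs_cvm_sub_gridSum_le`). This reduces questions about `D` to finite Dirichlet vectors. The
cells of the grid all have `G`-mass `1/m`, so the law of the Riemann sum, and in the limit that of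
`D`, is free of `G` (`map_cvm_eq`); hence the data-dependent cells are in fact deterministic.

Concentration: Chebyshev's inequality for gamma variables gives `P(A) ≈ H_x(A)` under the posterior,
and the strong law gives `H_x(A) → P_true(A)`. Finitely many half-lines then control `D`
(`ae_tendsto_posterior_deviation`). Under the hypothesis `d* = 0`, and `d_{i₀/M} > 0` because the
prior of `D` has no atom at `0`; so the null cell takes all the posterior mass.

For the strength in (ii), a cell that counts has posterior mass at most its prior mass times the
ratio `r` of the null cell, so the strength is at most the null cell's posterior mass plus `M r`
(`strength_le`), and both tend to `0`. This needs every non-empty cell to have positive prior mass.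
That holds because the support of `D` has no gaps (`cvm_Ioo_ne_zero`): Dirichlet vectors charge
every relatively open piece of the open simplex, which is connected. -/

lemma gammaOne_of_pos {α : ℝ} (hα : 0 < α) : gammaOne α = gammaMeasure α 1 := by
  simp [gammaOne, hα.ne']

lemma isProbabilityMeasure_gammaOne {α : ℝ} (hα : 0 ≤ α) : IsProbabilityMeasure (gammaOne α) := by
  rcases hα.eq_or_lt with rfl | h
  · simp only [gammaOne, if_true]; infer_instance
  · rw [gammaOne_of_pos h]; exact isProbabilityMeasure_gammaMeasure h one_pos

lemma gammaOne_absolutelyContinuous {α : ℝ} (hα : 0 < α) : gammaOne α ≪ volume := by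
  rw [gammaOne_of_pos hα]; exact withDensity_absolutelyContinuous _ _

lemma measurable_gammaPDF (α : ℝ) : Measurable (gammaPDF α 1) :=
  (measurable_gammaPDFReal α 1).ennreal_ofReal

lemma gammaOne_ae_pos {α : ℝ} (hα : 0 < α) : ∀ᵐ z ∂gammaOne α, 0 < z := by
  have h0 : ∀ᵐ z ∂gammaOne α, z ≠ 0 :=
    (gammaOne_absolutelyContinuous hα).ae_le (Measure.ae_ne volume 0)
  have h1 : ∀ᵐ z ∂gammaOne α, 0 ≤ z := by
    rw [gammaOne_of_pos hα, gammaMeasure, ae_withDensity_iff (measurable_gammaPDF α)]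
    refine ae_of_all _ fun z hz => ?_
    by_contra h
    exact hz (gammaPDF_of_neg (not_le.1 h))
  filter_upwards [h0, h1] with z a b using lt_of_le_of_ne b a.symm

lemma gammaOne_pos_of_isOpen {α : ℝ} (hα : 0 < α) {U : Set ℝ} (hU : IsOpen U) {z : ℝ}
    (hz : 0 < z) (hzU : z ∈ U) : gammaOne α U ≠ 0 := by
  intro h
  rw [gammaOne_of_pos hα, gammaMeasure,
    withDensity_apply_eq_zero (measurable_gammaPDF α)] at h
  have hV : IsOpen (U ∩ Ioi 0) := hU.inter isOpen_Ioi
  refine (hV.measure_pos volume ⟨z, hzU, hz⟩).ne' (measure_mono_null ?_ h)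
  rintro y ⟨hy, hy0⟩
  refine ⟨?_, hy⟩
  simpa [gammaPDF] using gammaPDFReal_pos hα one_pos hy0

/-- The variance of the gamma distribution. -/
lemma lintegral_sq_sub_gammaOne {α : ℝ} (hα : 0 ≤ α) :
    ∫⁻ z, ENNReal.ofReal ((z - α) ^ 2) ∂gammaOne α = ENNReal.ofReal α := by
  rcases hα.eq_or_lt with rfl | h
  · simp [gammaOne]
  have hmeas : Measurable fun z : ℝ => ENNReal.ofReal ((z - α) ^ 2) := by fun_prop
  have hres : gammaOne α = (gammaOne α).restrict (Ioi 0) :=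
    (Measure.restrict_eq_self_of_ae_mem (gammaOne_ae_pos h)).symm
  have hG : 0 < Real.Gamma α := Real.Gamma_pos_of_pos h
  have e0 := Real.GammaIntegral_convergent h
  have e1 := Real.GammaIntegral_convergent (by linarith : 0 < α + 1)
  have e2 := Real.GammaIntegral_convergent (by linarith : 0 < α + 1 + 1)
  -- The square is expanded so that the three integrals are `Γ(α+2)`, `Γ(α+1)` and `Γ(α)`; after
  -- division by `Γ(α)` they give `(α+1)α - 2α² + α² = α`. The exponents keep the shape `s - 1` of
  -- the Gamma integral.
  have hi : IntegrableOn (fun z : ℝ => (Real.Gamma α)⁻¹ * (Real.exp (-z) * z ^ (α + 1 + 1 - 1) -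
      2 * α * (Real.exp (-z) * z ^ (α + 1 - 1)) + α ^ 2 * (Real.exp (-z) * z ^ (α - 1)))) (Ioi 0) :=
    ((e2.sub (e1.const_mul (2 * α))).add (e0.const_mul (α ^ 2))).const_mul (Real.Gamma α)⁻¹
  have key : ∀ z ∈ Ioi (0 : ℝ), gammaPDF α 1 z * ENNReal.ofReal ((z - α) ^ 2) =
      ENNReal.ofReal ((Real.Gamma α)⁻¹ * (Real.exp (-z) * z ^ (α + 1 + 1 - 1) -
        2 * α * (Real.exp (-z) * z ^ (α + 1 - 1)) + α ^ 2 * (Real.exp (-z) * z ^ (α - 1)))) := by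
    intro z hz
    have hz : 0 < z := hz
    rw [gammaPDF, ← ENNReal.ofReal_mul (gammaPDFReal_nonneg h one_pos z), gammaPDFReal,
      if_pos hz.le]
    congr 1
    have h1 : z ^ (α + 1 - 1) = z ^ (α - 1) * z := by
      rw [← Real.rpow_add_one hz.ne']; congr 1; ring
    have h2 : z ^ (α + 1 + 1 - 1) = z ^ (α - 1) * z * z := by
      rw [← Real.rpow_add_one hz.ne', ← Real.rpow_add_one hz.ne']; congr 1; ring
    rw [h1, h2, Real.one_rpow, one_mul]
    ring
  rw [hres, gammaOne_of_pos h, gammaMeasure, restrict_withDensity measurableSet_Ioi,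
    lintegral_withDensity_eq_lintegral_mul _ (measurable_gammaPDF α) hmeas,
    show (fun z => (gammaPDF α 1 * fun z => ENNReal.ofReal ((z - α) ^ 2)) z) =
      fun z => gammaPDF α 1 z * ENNReal.ofReal ((z - α) ^ 2) from rfl,
    setLIntegral_congr_fun measurableSet_Ioi key]
  rw [← ofReal_integral_eq_lintegral_ofReal hi]
  · congr 1
    have e21 : IntegrableOn (fun z : ℝ => Real.exp (-z) * z ^ (α + 1 + 1 - 1) -
        2 * α * (Real.exp (-z) * z ^ (α + 1 - 1))) (Ioi 0) := e2.sub (e1.const_mul _)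
    rw [integral_const_mul, integral_add e21 (e0.const_mul _), integral_sub e2 (e1.const_mul _),
      integral_const_mul, integral_const_mul,
      ← Real.Gamma_eq_integral h, ← Real.Gamma_eq_integral (by linarith),
      ← Real.Gamma_eq_integral (by linarith), Real.Gamma_add_one (by linarith),
      Real.Gamma_add_one h.ne']
    field_simp
    ring
  · filter_upwards [ae_restrict_mem measurableSet_Ioi] with z hz
    have hz : 0 < z := hz
    have h1 : z ^ (α + 1 - 1) = z ^ (α - 1) * z := by
      rw [← Real.rpow_add_one hz.ne']; congr 1; ring
    have h2 : z ^ (α + 1 + 1 - 1) = z ^ (α - 1) * z * z := by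
      rw [← Real.rpow_add_one hz.ne', ← Real.rpow_add_one hz.ne']; congr 1; ring
    have : (Real.Gamma α)⁻¹ * (Real.exp (-z) * z ^ (α + 1 + 1 - 1) -
        2 * α * (Real.exp (-z) * z ^ (α + 1 - 1)) + α ^ 2 * (Real.exp (-z) * z ^ (α - 1))) =
        (Real.Gamma α)⁻¹ * (Real.exp (-z) * z ^ (α - 1) * (z - α) ^ 2) := by
      rw [h1, h2]; ring
    rw [Pi.zero_apply, this]
    positivity

/-- Chebyshev's inequality for the gamma distribution. -/
lemma gammaOne_deviation {α : ℝ} (hα : 0 ≤ α) {c : ℝ} (hc : 0 < c) :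
    gammaOne α {z | c < |z - α|} ≤ ENNReal.ofReal (α / c ^ 2) := by
  have := meas_ge_le_lintegral_div (μ := gammaOne α)
    (f := fun z : ℝ => ENNReal.ofReal ((z - α) ^ 2)) (by fun_prop)
    (ε := ENNReal.ofReal (c ^ 2)) (by simp [hc.ne']) ENNReal.ofReal_ne_top
  rw [lintegral_sq_sub_gammaOne hα, ← ENNReal.ofReal_div_of_pos (by positivity)] at this
  refine (measure_mono fun z hz => ?_).trans this
  refine ENNReal.ofReal_le_ofReal ?_
  rw [← sq_abs (z - α)]
  exact pow_le_pow_left₀ hc.le (le_of_lt hz) 2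

lemma measurable_normalize {k : ℕ} :
    Measurable fun (z : Fin k → ℝ) i => z i / ∑ j, z j := by
  fun_prop

/-- A beta variable concentrates at its mean as the sum of the parameters grows. -/
lemma dirichlet_two_deviation {α : Fin 2 → ℝ} (hα : ∀ i, 0 ≤ α i) (hs : 0 < α 0 + α 1)
    {η : ℝ} (hη : 0 < η) (hη' : η ≤ 1 / 4) :
    dirichlet α {v | 2 * η < |v 0 - α 0 / (α 0 + α 1)|} ≤
      ENNReal.ofReal (1 / (η ^ 2 * (α 0 + α 1))) := by
  have hp : ∀ i, IsProbabilityMeasure (gammaOne (α i)) :=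
    fun i => isProbabilityMeasure_gammaOne (hα i)
  set s := α 0 + α 1 with hsdef
  have hm : MeasurableSet {v : Fin 2 → ℝ | 2 * η < |v 0 - α 0 / s|} :=
    measurableSet_lt measurable_const (by fun_prop)
  rw [dirichlet, Measure.map_apply measurable_normalize hm]
  have hdev : ∀ i, (Measure.pi fun i => gammaOne (α i)) {z | η * s < |z i - α i|} ≤
      ENNReal.ofReal (α i / (η * s) ^ 2) := by
    intro i
    have h := (measurePreserving_eval (fun i => gammaOne (α i)) i).measure_preimage
      (s := {z | η * s < |z - α i|})
      (measurableSet_lt measurable_const (by fun_prop)).nullMeasurableSet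
    exact h.trans_le (gammaOne_deviation (hα i) (by positivity))
  calc _ ≤ (Measure.pi fun i => gammaOne (α i))
        ({z | η * s < |z 0 - α 0|} ∪ {z | η * s < |z 1 - α 1|}) := by
        refine measure_mono fun z hz => ?_
        by_contra hcon
        simp only [mem_union, mem_ofPred_eq, not_or, not_lt] at hcon
        obtain ⟨h0, h1⟩ := hcon
        refine absurd hz ?_
        simp only [mem_preimage, mem_ofPred_eq, not_lt, Fin.sum_univ_two]
        rw [abs_le] at h0 h1
        -- Here `η ≤ 1/4` enters: the sum is at least `s - 2ηs`. With both deviations at most `ηs`,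
        -- the numerator below is at most `ηs²` and the denominator at least `s²/2`, whence the
        -- bound `2η`.
        have hS : s / 2 ≤ z 0 + z 1 := by nlinarith
        have hS0 : 0 < z 0 + z 1 := by linarith
        have e : z 0 / (z 0 + z 1) - α 0 / s =
            (α 1 * (z 0 - α 0) - α 0 * (z 1 - α 1)) / ((z 0 + z 1) * s) := by
          rw [hsdef] at hs ⊢
          field_simp
          ring
        rw [e, abs_div, abs_of_pos (mul_pos hS0 hs), div_le_iff₀ (mul_pos hS0 hs), abs_le]
        have a0 := hα 0
        have a1 := hα 1
        have b1 : η * s * s ≤ 2 * η * ((z 0 + z 1) * s) := by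
          have := mul_le_mul_of_nonneg_left hS (by positivity : 0 ≤ 2 * η * s)
          nlinarith
        have c0 := mul_le_mul_of_nonneg_left h0.1 a1
        have c1 := mul_le_mul_of_nonneg_left h0.2 a1
        have c2 := mul_le_mul_of_nonneg_left h1.1 a0
        have c3 := mul_le_mul_of_nonneg_left h1.2 a0
        have e2 : η * s * s = α 1 * (η * s) + α 0 * (η * s) := by rw [hsdef]; ring
        constructor <;> nlinarith
    _ ≤ _ := measure_union_le _ _
    _ ≤ ENNReal.ofReal (α 0 / (η * s) ^ 2) + ENNReal.ofReal (α 1 / (η * s) ^ 2) :=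
        add_le_add (hdev 0) (hdev 1)
    _ = ENNReal.ofReal (1 / (η ^ 2 * s)) := by
        rw [← ENNReal.ofReal_add (div_nonneg (hα 0) (by positivity))
          (div_nonneg (hα 1) (by positivity)), ← add_div, ← hsdef]
        congr 1
        field_simp

/-- The symmetric beta distribution has no atom at `1 / 2`. -/
lemma dirichlet_two_half {α : Fin 2 → ℝ} (hα : ∀ i, 0 < α i) :
    dirichlet α {v | v 0 = 1 / 2} = 0 := by
  have hp : ∀ i, IsProbabilityMeasure (gammaOne (α i)) :=
    fun i => isProbabilityMeasure_gammaOne (hα i).le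
  rw [dirichlet, Measure.map_apply measurable_normalize
    (measurableSet_eq_fun (by fun_prop) measurable_const)]
  refine measure_mono_null (t := {z : Fin 2 → ℝ | z 0 = z 1}) (fun z hz => ?_) ?_
  · simp only [mem_preimage, mem_ofPred_eq, Fin.sum_univ_two] at hz ⊢
    -- A vanishing sum makes the quotient `0` by convention, which is not `1/2`. The event thus lies
    -- in the diagonal, which is null because its sections are points.
    have hne : z 0 + z 1 ≠ 0 := fun h => by simp [h] at hz
    field_simp at hz
    linarith
  · have hvec : (fun i => gammaOne (α i)) = ![gammaOne (α 0), gammaOne (α 1)] := by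
      ext i; fin_cases i <;> rfl
    have := hp 0
    have := hp 1
    have hm : MeasurableSet {p : ℝ × ℝ | p.1 = p.2} :=
      measurableSet_eq_fun measurable_fst measurable_snd
    have hpre := (measurePreserving_finTwoArrow_vec (gammaOne (α 0))
      (gammaOne (α 1))).measure_preimage hm.nullMeasurableSet
    rw [hvec]
    refine hpre.trans ((Measure.measure_prod_null hm).2 (ae_of_all _ fun x => ?_))
    refine gammaOne_absolutelyContinuous (hα 1) (measure_mono_null (t := {x}) ?_ (by simp))
    intro y hy
    exact (Eq.symm hy : y = x)

/-- The normalization of a vector with independent gamma coordinates hits every open event that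
is met by the normalization of some positive vector. -/
lemma dirichlet_ne_zero_of_isOpen {k : ℕ} {α : Fin k → ℝ} (hα : ∀ i, 0 < α i)
    {U : Set (Fin k → ℝ)} (hU : IsOpen U) {z : Fin k → ℝ} (hz : ∀ i, 0 < z i)
    (hk : 0 < k) (hzU : (fun i => z i / ∑ j, z j) ∈ U) : dirichlet α U ≠ 0 := by
  have hp : ∀ i, IsProbabilityMeasure (gammaOne (α i)) :=
    fun i => isProbabilityMeasure_gammaOne (hα i).le
  rw [dirichlet, Measure.map_apply measurable_normalize hU.measurableSet]
  have : NeZero k := ⟨hk.ne'⟩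
  have hsum : (∑ j, z j) ≠ 0 := (Finset.sum_pos (fun i _ => hz i) Finset.univ_nonempty).ne'
  have hc : ContinuousAt (fun (z : Fin k → ℝ) i => z i / ∑ j, z j) z :=
    continuousAt_pi.2 fun i => ContinuousAt.div (continuous_apply i).continuousAt (by fun_prop) hsum
  have hnhds := hc.preimage_mem_nhds (hU.mem_nhds hzU)
  rw [nhds_pi, Filter.mem_pi'] at hnhds
  obtain ⟨I, t, ht, hsub⟩ := hnhds
  intro h0
  have h1 : (Measure.pi fun i => gammaOne (α i)) (univ.pi fun i => interior (t i)) = 0 := by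
    refine measure_mono_null (fun y hy => hsub fun i _ => interior_subset (hy i trivial)) h0
  rw [Measure.pi_pi, Finset.prod_eq_zero_iff] at h1
  obtain ⟨i, -, hi⟩ := h1
  exact gammaOne_pos_of_isOpen (hα i) isOpen_interior (hz i) (mem_interior_iff_mem_nhds.2 (ht i)) hi

/-- A non-null event of a Dirichlet distribution contains the normalization of a positive
vector. -/
lemma exists_pos_of_dirichlet_ne_zero {k : ℕ} {α : Fin k → ℝ} (hα : ∀ i, 0 < α i)
    {U : Set (Fin k → ℝ)} (hU : MeasurableSet U) (h : dirichlet α U ≠ 0) :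
    ∃ z : Fin k → ℝ, (∀ i, 0 < z i) ∧ (fun i => z i / ∑ j, z j) ∈ U := by
  have hp : ∀ i, IsProbabilityMeasure (gammaOne (α i)) :=
    fun i => isProbabilityMeasure_gammaOne (hα i).le
  rw [dirichlet, Measure.map_apply measurable_normalize hU] at h
  have hpos : ∀ᵐ z ∂(Measure.pi fun i => gammaOne (α i)), ∀ i, 0 < z i :=
    eventually_all.2 fun i =>
      (Measure.tendsto_eval_ae_ae (μ := fun i => gammaOne (α i))).eventually
        (gammaOne_ae_pos (hα i))
  by_contra! hcon
  refine h (measure_mono_null (fun z hz => ?_) hpos)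
  exact fun hz' => hcon z hz' hz
/-! ### Grids and Riemann sums for the Cramér–von Mises distance -/

/-- An increasing sequence of half-lines `E₀ = ∅ ⊆ E₁ ⊆ ⋯ ⊆ Eₘ = ℝ`. -/
structure IsGrid (m : ℕ) (E : ℕ → Set ℝ) : Prop where
  zero : E 0 = ∅
  top : E m = univ
  mono : Monotone E
  form : ∀ j, E j = ∅ ∨ E j = univ ∨ ∃ q, E j = Iic q

lemma IsGrid.measurableSet {m : ℕ} {E : ℕ → Set ℝ} (h : IsGrid m E) (j : ℕ) :
    MeasurableSet (E j) := by
  rcases h.form j with e | e | ⟨q, e⟩ <;> rw [e]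
  exacts [MeasurableSet.empty, MeasurableSet.univ, measurableSet_Iic]

lemma IsGrid.isLowerSet {m : ℕ} {E : ℕ → Set ℝ} (h : IsGrid m E) (j : ℕ) :
    IsLowerSet (E j) := by
  rcases h.form j with e | e | ⟨q, e⟩ <;> rw [e]
  exacts [isLowerSet_empty, isLowerSet_univ, isLowerSet_Iic q]

lemma exists_cdf_eq (G : Measure ℝ) (hG : Continuous (cdf G)) {p : ℝ} (h0 : 0 < p)
    (h1 : p < 1) : ∃ q, cdf G q = p := by
  obtain ⟨x, hx⟩ := ((tendsto_cdf_atBot G).eventually (gt_mem_nhds h0)).exists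
  obtain ⟨y, hy⟩ := ((tendsto_cdf_atTop G).eventually (lt_mem_nhds h1)).exists
  exact mem_range_of_exists_le_of_exists_ge hG ⟨x, hx.le⟩ ⟨y, hy.le⟩

/-- A continuous distribution has a grid of quantiles of the orders `j / m`. -/
lemma exists_quantile_grid (G : Measure ℝ) [IsProbabilityMeasure G] (hG : Continuous (cdf G))
    {m : ℕ} (hm : 0 < m) :
    ∃ E, IsGrid m E ∧ ∀ j ≤ m, G.real (E j) = j / m := by
  have hm' : (0 : ℝ) < m := by exact_mod_cast hm
  -- Guarding the equation by `0 < j < m` lets `choose` return a total sequence; the value `0`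
  -- elsewhere is never used.
  have hex : ∀ j : ℕ, ∃ q, 0 < j → j < m → cdf G q = j / m := by
    intro j
    by_cases h : 0 < j ∧ j < m
    · obtain ⟨q, hq⟩ := exists_cdf_eq G hG (p := (j : ℝ) / m)
        (div_pos (by exact_mod_cast h.1) hm') ((div_lt_one hm').2 (by exact_mod_cast h.2))
      exact ⟨q, fun _ _ => hq⟩
    · exact ⟨0, fun h1 h2 => absurd ⟨h1, h2⟩ h⟩
  choose q hq using hex
  refine ⟨fun j => if j = 0 then ∅ else if j < m then Iic (q j) else univ, ⟨?_, ?_, ?_, ?_⟩, ?_⟩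
  · simp
  · simp [hm.ne']
  · intro i j hij
    by_cases hi : i = 0
    · simp [hi]
    have hj : j ≠ 0 := by omega
    by_cases hjm : j < m
    · have him : i < m := by omega
      simp only [hi, hj, hjm, him, if_true, if_false]
      rcases hij.eq_or_lt with rfl | hlt
      · exact le_rfl
      refine Iic_subset_Iic.2 (le_of_not_gt fun h => ?_)
      have := monotone_cdf G h.le
      rw [hq i (by omega) him, hq j (by omega) hjm, div_le_div_iff_of_pos_right hm'] at this
      exact absurd (by exact_mod_cast this) (not_le.2 hlt)
    · simp [hj, hjm]
  · intro j
    by_cases hj : j = 0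
    · simp [hj]
    by_cases hjm : j < m
    · exact Or.inr (Or.inr ⟨q j, by simp [hj, hjm]⟩)
    · simp [hj, hjm]
  · intro j hjm
    by_cases hj : j = 0
    · simp [hj]
    rcases hjm.eq_or_lt with rfl | hlt
    · simp [hj]
    · simp only [hj, hlt, if_true, if_false]
      rw [← cdf_eq_real, hq j (by omega) hlt]

/-- The Riemann sum for `∫₀¹ (P(G⁻¹(u)) - u)² du` along a grid. -/
noncomputable def gridSum (E : ℕ → Set ℝ) (m : ℕ) (P : Measure ℝ) : ℝ :=
  (∑ j ∈ Finset.range m, (P.real (E j) - j / m) ^ 2) / m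

lemma integrable_sq_cdf_sub (P G : Measure ℝ) [IsProbabilityMeasure G] :
    Integrable (fun x => (cdf P x - cdf G x) ^ 2) G := by
  refine Integrable.of_bound (C := 1) ?_ (ae_of_all _ fun x => ?_)
  · exact (((monotone_cdf P).measurable.sub (monotone_cdf G).measurable).pow_const
      2).aestronglyMeasurable
  · rw [Real.norm_of_nonneg (sq_nonneg _), sq_le_one_iff_abs_le_one, abs_le]
    have := cdf_nonneg P x
    have := cdf_nonneg G x
    have := cdf_le_one P x
    have := cdf_le_one G x
    constructor <;> linarith

lemma cvm_nonneg (P G : Measure ℝ) : 0 ≤ cvm P G :=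
  integral_nonneg fun _ => sq_nonneg _

lemma abs_sq_sub_sq_le {x y a b : ℝ} (hx : x ∈ Icc (0 : ℝ) 1) (hy : y ∈ Icc (0 : ℝ) 1)
    (ha : a ∈ Icc (0 : ℝ) 1) (hb : b ∈ Icc (0 : ℝ) 1) :
    |(x - y) ^ 2 - (a - b) ^ 2| ≤ 2 * |x - a| + 2 * |y - b| := by
  have e : (x - y) ^ 2 - (a - b) ^ 2 = ((x - y) + (a - b)) * ((x - a) - (y - b)) := by ring
  rw [e, abs_mul]
  have h1 : |(x - y) + (a - b)| ≤ 2 := by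
    rw [abs_le]
    constructor <;> linarith [hx.1, hx.2, hy.1, hy.2, ha.1, ha.2, hb.1, hb.2]
  have h2 := abs_sub (x - a) (y - b)
  calc _ ≤ 2 * (|x - a| + |y - b|) :=
        mul_le_mul h1 h2 (abs_nonneg _) (by norm_num)
    _ = _ := by ring

/-- Between consecutive half-lines both cdfs are trapped between their end values, so the integrand
varies by little more than the increments of `P` and `G`, and these telescope. The slack `ε` allows
a grid made of quantiles of a distribution other than `G`, as is needed when `G = F_{θ(x)}` moves
with the sample and the grid belongs to `F_θ₀`. -/
lemma abs_cvm_sub_gridSum_le {m : ℕ} (hm : 0 < m) {E : ℕ → Set ℝ} (hE : IsGrid m E)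
    (P G : Measure ℝ) [IsProbabilityMeasure P] [IsProbabilityMeasure G] {ε : ℝ}
    (hG : ∀ j ≤ m, |G.real (E j) - j / m| ≤ ε) :
    |cvm P G - gridSum E m P| ≤ 4 / m + 10 * ε + 2 * m * ε := by
  have hm' : (0 : ℝ) < m := by exact_mod_cast hm
  set f : ℝ → ℝ := fun x => (cdf P x - cdf G x) ^ 2 with hf
  have hfi : Integrable f G := integrable_sq_cdf_sub P G
  set p : ℕ → ℝ := fun j => P.real (E j) with hp
  set g : ℕ → ℝ := fun j => G.real (E j) with hg
  set I : ℕ → ℝ := fun j => ∫ x in E j, f x ∂G with hI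
  have hpm : ∀ j, p j ≤ p (j + 1) := fun j => measureReal_mono (hE.mono (Nat.le_succ j))
  have hgm : ∀ j, g j ≤ g (j + 1) := fun j => measureReal_mono (hE.mono (Nat.le_succ j))
  have hpI : ∀ j, p j ∈ Icc (0 : ℝ) 1 := fun j => ⟨measureReal_nonneg, measureReal_le_one⟩
  have hcvm : cvm P G = ∑ j ∈ Finset.range m, (I (j + 1) - I j) := by
    rw [Finset.sum_range_sub]
    simp [hI, hE.zero, hE.top, cvm, hf]
  -- The factor `1/m + 2ε` bounds one increment of `G`. The other factor sums to `4`, giving `4/m +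
  -- 8ε`; the remaining terms add `2ε` and `2mε`.
  have hterm : ∀ j ∈ Finset.range m, |(I (j + 1) - I j) - (p j - j / m) ^ 2 / m| ≤
      (2 * (p (j + 1) - p j) + 2 * (g (j + 1) - g j)) * (1 / m + 2 * ε) +
        2 * ε * (g (j + 1) - g j) + 2 * ε := by
    intro j hj
    have hjm : j < m := Finset.mem_range.1 hj
    have hjI : (j : ℝ) / m ∈ Icc (0 : ℝ) 1 :=
      ⟨by positivity, (div_le_one hm').2 (by exact_mod_cast hjm.le)⟩
    have h0 := abs_le.1 (hG j hjm.le)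
    have h1 := abs_le.1 (hG (j + 1) hjm)
    have hstep : ((j + 1 : ℕ) : ℝ) / m = j / m + 1 / m := by push_cast; ring
    rw [hstep] at h1
    set c : ℝ := (p j - j / m) ^ 2 with hc
    have hc1 : c ≤ 1 := by
      rw [hc, sq_le_one_iff_abs_le_one, abs_le]
      constructor <;> linarith [(hpI j).1, (hpI j).2, hjI.1, hjI.2]
    have hc0 : 0 ≤ c := sq_nonneg _
    have hA : MeasurableSet (E (j + 1) \ E j) := (hE.measurableSet _).diff (hE.measurableSet _)
    have hGA : G.real (E (j + 1) \ E j) = g (j + 1) - g j :=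
      measureReal_sdiff (hE.mono (Nat.le_succ j)) (hE.measurableSet j)
    have hIA : I (j + 1) - I j - c * (g (j + 1) - g j) =
        ∫ x in E (j + 1) \ E j, (f x - c) ∂G := by
      rw [integral_sub hfi.integrableOn (integrable_const _), setIntegral_const, hGA,
        setIntegral_sdiff (hE.measurableSet j) hfi.integrableOn (hE.mono (Nat.le_succ j)),
        smul_eq_mul, mul_comm]
    have hbound : |∫ x in E (j + 1) \ E j, (f x - c) ∂G| ≤
        (2 * (p (j + 1) - p j) + 2 * (g (j + 1) - g j) + 2 * ε) * (g (j + 1) - g j) := by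
      rw [← hGA, ← Real.norm_eq_abs]
      refine norm_setIntegral_le_of_norm_le_const (measure_lt_top _ _) fun x hx => ?_
      -- `x` lies in `E (j + 1)` but not in `E j`, and both are lower sets, so `Iic x` is squeezed
      -- between them.
      have hl : E j ⊆ Iic x := fun y hy => le_of_not_gt fun hxy =>
        hx.2 (hE.isLowerSet j (le_of_lt hxy) hy)
      have hu : Iic x ⊆ E (j + 1) := fun y hy => hE.isLowerSet (j + 1) hy hx.1
      have a1 : p j ≤ cdf P x := by rw [cdf_eq_real]; exact measureReal_mono hl
      have a2 : cdf P x ≤ p (j + 1) := by rw [cdf_eq_real]; exact measureReal_mono hu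
      have a3 : g j ≤ cdf G x := by rw [cdf_eq_real]; exact measureReal_mono hl
      have a4 : cdf G x ≤ g (j + 1) := by rw [cdf_eq_real]; exact measureReal_mono hu
      rw [Real.norm_eq_abs, hf, hc]
      refine (abs_sq_sub_sq_le ⟨cdf_nonneg P x, cdf_le_one P x⟩
        ⟨cdf_nonneg G x, cdf_le_one G x⟩ (hpI j) hjI).trans ?_
      have b1 : |cdf P x - p j| ≤ p (j + 1) - p j := by
        rw [abs_le]; constructor <;> linarith
      have b2 : |cdf G x - j / m| ≤ g (j + 1) - g j + ε := by
        rw [abs_le]; constructor <;> linarith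
      linarith
    rw [← hIA] at hbound
    have hd : |c * (g (j + 1) - g j) - c / m| ≤ 2 * ε := by
      have : c * (g (j + 1) - g j) - c / m = c * (g (j + 1) - g j - 1 / m) := by ring
      rw [this, abs_mul, abs_of_nonneg hc0]
      have h2 : |g (j + 1) - g j - 1 / m| ≤ 2 * ε := by
        rw [abs_le]; constructor <;> linarith
      calc _ ≤ 1 * (2 * ε) := mul_le_mul hc1 h2 (abs_nonneg _) zero_le_one
        _ = _ := one_mul _
    have hgb : g (j + 1) - g j ≤ 1 / m + 2 * ε := by linarith
    have hmul := mul_le_mul_of_nonneg_left hgb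
      (by linarith [hpm j, hgm j] : 0 ≤ 2 * (p (j + 1) - p j) + 2 * (g (j + 1) - g j))
    have htri := abs_add_le (I (j + 1) - I j - c * (g (j + 1) - g j))
      (c * (g (j + 1) - g j) - c / m)
    rw [sub_add_sub_cancel] at htri
    linarith
  have hsum : cvm P G - gridSum E m P =
      ∑ j ∈ Finset.range m, ((I (j + 1) - I j) - (p j - j / m) ^ 2 / m) := by
    rw [Finset.sum_sub_distrib, ← hcvm, gridSum, Finset.sum_div]
  have hp0 : p 0 = 0 := by simp [hp, hE.zero]
  have hg0 : g 0 = 0 := by simp [hg, hE.zero]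
  have hp1 : p m = 1 := by simp [hp, hE.top]
  have hg1 : g m = 1 := by simp [hg, hE.top]
  calc _ ≤ ∑ j ∈ Finset.range m, ((2 * (p (j + 1) - p j) + 2 * (g (j + 1) - g j)) *
        (1 / m + 2 * ε) + 2 * ε * (g (j + 1) - g j) + 2 * ε) := by
        rw [hsum]
        exact (Finset.abs_sum_le_sum_abs _ _).trans (Finset.sum_le_sum hterm)
    _ = 4 / m + 10 * ε + 2 * m * ε := by
        rw [Finset.sum_add_distrib, Finset.sum_add_distrib, ← Finset.sum_mul, ← Finset.mul_sum,
          Finset.sum_add_distrib, ← Finset.mul_sum, ← Finset.mul_sum, Finset.sum_range_sub,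
          Finset.sum_range_sub, hp0, hg0, hp1, hg1, Finset.sum_const, Finset.card_range,
          nsmul_eq_mul]
        ring

lemma measurable_real_apply {A : Set ℝ} (hA : MeasurableSet A) :
    Measurable fun P : ProbabilityMeasure ℝ => (P : Measure ℝ).real A :=
  ((Measure.measurable_coe hA).comp measurable_subtype_coe).ennreal_toReal

lemma measurable_gridSum {m : ℕ} {E : ℕ → Set ℝ} (hE : IsGrid m E) :
    Measurable fun P : ProbabilityMeasure ℝ => gridSum E m (P : Measure ℝ) :=
  (Finset.measurable_fun_sum _ fun j _ =>
    ((measurable_real_apply (hE.measurableSet j)).sub_const _).pow_const 2).div_const _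

lemma abs_cvm_sub_gridSum_le_of_quantile {m : ℕ} (hm : 0 < m) {E : ℕ → Set ℝ} (hE : IsGrid m E)
    (P G : Measure ℝ) [IsProbabilityMeasure P] [IsProbabilityMeasure G]
    (hG : ∀ j ≤ m, G.real (E j) = j / m) :
    |cvm P G - gridSum E m P| ≤ 4 / m := by
  have := abs_cvm_sub_gridSum_le hm hE P G (ε := 0) (fun j hj => by simp [hG j hj])
  simpa using this

lemma tendsto_gridSum {E : ℕ → ℕ → Set ℝ} (hE : ∀ m, IsGrid (m + 1) (E m))
    (P G : Measure ℝ) [IsProbabilityMeasure P] [IsProbabilityMeasure G]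
    (hG : ∀ m, ∀ j ≤ m + 1, G.real (E m j) = j / (m + 1 : ℕ)) :
    Tendsto (fun m => gridSum (E m) (m + 1) P) atTop (𝓝 (cvm P G)) := by
  rw [tendsto_iff_dist_tendsto_zero]
  refine squeeze_zero (fun _ => dist_nonneg) (fun m => ?_)
    ((tendsto_const_div_atTop_nhds_zero_nat 4).comp (tendsto_add_atTop_nat 1))
  rw [dist_comm, Real.dist_eq]
  exact abs_cvm_sub_gridSum_le_of_quantile m.succ_pos (hE m) P G (hG m)

/-- The distance is a pointwise limit of grid sums, each a function of finitely many evaluations `P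
↦ P A`. -/
lemma measurable_cvm (G : Measure ℝ) [IsProbabilityMeasure G] (hG : Continuous (cdf G)) :
    Measurable fun P : ProbabilityMeasure ℝ => cvm (P : Measure ℝ) G := by
  choose E hE hEG using fun m : ℕ => exists_quantile_grid G hG m.succ_pos
  exact measurable_of_tendsto_metrizable (fun m => measurable_gridSum (hE m))
    (tendsto_pi_nhds.2 fun P => tendsto_gridSum hE P G hEG)

/-- If the distance between `P` and `G` vanishes, then `P` gives a quantile half-line of `G` the
same probability as `G`. -/
lemma real_Iic_eq_of_cvm_eq_zero (P G : Measure ℝ) [IsProbabilityMeasure P]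
    [IsProbabilityMeasure G] (hG : Continuous (cdf G)) (h : cvm P G = 0) {q : ℝ}
    (h0 : 0 < cdf G q) (h1 : cdf G q < 1) : P.real (Iic q) = cdf G q := by
  rw [← cdf_eq_real]
  have hae : ∀ᵐ x ∂G, cdf P x = cdf G x := by
    have := (integral_eq_zero_iff_of_nonneg (fun _ => sq_nonneg _)
      (integrable_sq_cdf_sub P G)).1 h
    filter_upwards [this] with x hx
    exact sub_eq_zero.1 (pow_eq_zero_iff two_ne_zero |>.1 hx)
  -- An interval charged by `G` must contain a point where the cdfs agree. If they differed at `q`,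
  -- such a point between `q` and the place where `cdf G` is halfway to `cdf P q` would contradict
  -- monotonicity.
  have hex : ∀ s t, cdf G s < cdf G t → ∃ z ∈ Ioc s t, cdf P z = cdf G z := by
    intro s t hst
    have hle : s ≤ t := le_of_not_ge fun hts => not_le.2 hst (monotone_cdf G hts)
    have hpos : G (Ioc s t) ≠ 0 := by
      intro h0
      have := measureReal_sdiff (μ := G) (Iic_subset_Iic.2 hle) measurableSet_Iic
      rw [← cdf_eq_real, ← cdf_eq_real, Iic_sdiff_Iic, measureReal_def, h0] at this
      simp at this
      linarith
    by_contra! hcon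
    exact hpos (measure_mono_null (fun z hz => hcon z hz) hae)
  refine le_antisymm (le_of_not_gt fun hlt => ?_) (le_of_not_gt fun hlt => ?_)
  · obtain ⟨t, ht⟩ := exists_cdf_eq G hG (p := (cdf G q + cdf P q) / 2) (by linarith)
      (by linarith [cdf_le_one P q])
    obtain ⟨z, hz, hzz⟩ := hex q t (by linarith)
    linarith [monotone_cdf G hz.2, monotone_cdf P hz.1.le]
  · obtain ⟨t, ht⟩ := exists_cdf_eq G hG (p := (cdf G q + cdf P q) / 2)
      (by linarith [cdf_nonneg P q]) (by linarith)
    obtain ⟨z, hz, hzz⟩ := hex t q (by linarith)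
    linarith [monotone_cdf G hz.1.le, monotone_cdf P hz.2]
/-! ### Quantiles of a distribution on the line -/

/-- The lower `p`-quantile of a distribution on the line. -/
noncomputable def quantile (μ : Measure ℝ) (p : ℝ) : ℝ :=
  sInf {t | p ≤ μ.real (Iic t)}

section Quantile

variable {μ : Measure ℝ} [IsProbabilityMeasure μ] {p : ℝ}

lemma quantile_set_nonempty (h1 : p < 1) : {t | p ≤ μ.real (Iic t)}.Nonempty := by
  obtain ⟨t, ht⟩ := ((tendsto_cdf_atTop μ).eventually (lt_mem_nhds h1)).exists
  exact ⟨t, by rw [mem_ofPred_eq, ← cdf_eq_real]; exact ht.le⟩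

lemma quantile_set_bddBelow (h0 : 0 < p) : BddBelow {t | p ≤ μ.real (Iic t)} := by
  obtain ⟨t, ht⟩ := ((tendsto_cdf_atBot μ).eventually (gt_mem_nhds h0)).exists
  refine ⟨t, fun s hs => le_of_not_gt fun hst => ?_⟩
  rw [mem_ofPred_eq, ← cdf_eq_real] at hs
  linarith [monotone_cdf μ hst.le]

/-- Right-continuity of the cdf: a value below `p` at the infimum would persist just to its right.
-/
lemma le_real_Iic_quantile (h1 : p < 1) : p ≤ μ.real (Iic (quantile μ p)) := by
  rw [← cdf_eq_real]
  by_contra! hlt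
  have hev := ((cdf μ).right_continuous (quantile μ p)).eventually (gt_mem_nhds hlt)
  have hev' := hev.filter_mono (nhdsWithin_mono _ Ioi_subset_Ici_self)
  obtain ⟨t, ht, hqt⟩ := (hev'.and self_mem_nhdsWithin).exists
  obtain ⟨s, hs, hst⟩ := exists_lt_of_csInf_lt (quantile_set_nonempty h1) hqt
  rw [mem_ofPred_eq, ← cdf_eq_real] at hs
  linarith [monotone_cdf μ hst.le]

/-- Every point left of the infimum has cdf below `p`, and `Iio` is an increasing union of such
`Iic`. -/
lemma real_Iio_quantile_le (h0 : 0 < p) : μ.real (Iio (quantile μ p)) ≤ p := by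
  obtain ⟨u, hu, hlt, hlim⟩ := exists_seq_strictMono_tendsto (quantile μ p)
  have hU : ⋃ n, Iic (u n) = Iio (quantile μ p) := iUnion_Iic_eq_Iio_of_lt_of_tendsto hlt hlim
  have ht := tendsto_measure_iUnion_atTop (μ := μ) (s := fun n => Iic (u n))
    (fun i j hij => Iic_subset_Iic.2 (hu.monotone hij))
  rw [hU] at ht
  refine le_of_tendsto ((ENNReal.tendsto_toReal (measure_ne_top _ _)).comp ht)
    (Eventually.of_forall fun n => le_of_not_gt fun hn => ?_)
  exact not_le.2 (hlt n) (csInf_le (quantile_set_bddBelow h0) hn.le)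

end Quantile

/-! ### The distribution of the distance under a Dirichlet process -/

lemma isProbabilityMeasure_dirichlet {k : ℕ} {α : Fin k → ℝ} (hα : ∀ i, 0 ≤ α i) :
    IsProbabilityMeasure (dirichlet α) := by
  have hp : ∀ i, IsProbabilityMeasure (gammaOne (α i)) :=
    fun i => isProbabilityMeasure_gammaOne (hα i)
  exact Measure.isProbabilityMeasure_map measurable_normalize.aemeasurable

lemma measurable_real_vec {k : ℕ} {A : Fin k → Set ℝ} (hA : ∀ i, MeasurableSet (A i)) :
    Measurable fun (P : ProbabilityMeasure ℝ) i => (P : Measure ℝ).real (A i) :=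
  measurable_pi_lambda _ fun i => measurable_real_apply (hA i)

section DirichletProcess

variable {a : ℝ} {G : Measure ℝ} {law : Measure (ProbabilityMeasure ℝ)}

/-- The one-cell partition `{ℝ}` determines the total mass of `law`, and `dirichlet` is the image of
a product of probability measures. -/
lemma IsDirichletProcess.isProbabilityMeasure (h : IsDirichletProcess a G law) (ha : 0 ≤ a) :
    IsProbabilityMeasure law := by
  have h1 := h 1 (fun _ => univ) (fun _ => MeasurableSet.univ)
    (fun i j hij => absurd (Subsingleton.elim i j) hij) (iUnion_const _)
  have hp : IsProbabilityMeasure (dirichlet fun _ : Fin 1 => a * G.real univ) :=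
    isProbabilityMeasure_dirichlet fun _ => mul_nonneg ha measureReal_nonneg
  rw [← h1] at hp
  have := hp.measure_univ
  rw [Measure.map_apply (measurable_real_vec fun _ => MeasurableSet.univ) MeasurableSet.univ] at this
  exact ⟨this⟩

/-- The two-cell case of the definition of a Dirichlet process. -/
lemma IsDirichletProcess.map_pair (h : IsDirichletProcess a G law) {A : Set ℝ}
    (hA : MeasurableSet A) {U : Set (Fin 2 → ℝ)} (hU : MeasurableSet U) :
    law {P | (fun i => (P : Measure ℝ).real (![A, Aᶜ] i)) ∈ U} =
      dirichlet (fun i : Fin 2 => a * G.real (![A, Aᶜ] i)) U := by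
  have hm : ∀ i, MeasurableSet (![A, Aᶜ] i) := by
    intro i; fin_cases i
    exacts [hA, hA.compl]
  rw [← h 2 ![A, Aᶜ] hm ?_ ?_, Measure.map_apply (measurable_real_vec hm) hU]
  · rfl
  · intro i j hij
    fin_cases i <;> fin_cases j
    · exact absurd rfl hij
    · exact disjoint_compl_right
    · exact disjoint_compl_left
    · exact absurd rfl hij
  · ext x
    simp [Fin.exists_fin_two, em]

/-- A Dirichlet process concentrates at its base measure as the concentration parameter grows. -/
lemma IsDirichletProcess.deviation [IsProbabilityMeasure G] (h : IsDirichletProcess a G law)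
    (ha : 0 < a) {A : Set ℝ} (hA : MeasurableSet A) {η : ℝ} (hη : 0 < η) (hη' : η ≤ 1 / 4) :
    law {P | 2 * η < |(P : Measure ℝ).real A - G.real A|} ≤ ENNReal.ofReal (1 / (η ^ 2 * a)) := by
  set α : Fin 2 → ℝ := fun i => a * G.real (![A, Aᶜ] i) with hα
  have hα0 : α 0 = a * G.real A := rfl
  have hα1 : α 1 = a * G.real Aᶜ := rfl
  have hs : α 0 + α 1 = a := by
    rw [hα0, hα1, ← mul_add, probReal_add_probReal_compl hA, mul_one]
  have h2 := dirichlet_two_deviation (α := α) (fun i => mul_nonneg ha.le measureReal_nonneg)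
    (by rw [hs]; exact ha) hη hη'
  have hm : MeasurableSet {v : Fin 2 → ℝ | 2 * η < |v 0 - α 0 / (α 0 + α 1)|} :=
    measurableSet_lt measurable_const (by fun_prop)
  rw [← h.map_pair hA hm, hs, hα0, mul_div_cancel_left₀ _ ha.ne'] at h2
  exact h2

lemma IsDirichletProcess.real_eq_half_null (h : IsDirichletProcess a G law) (ha : 0 < a)
    {A : Set ℝ} (hA : MeasurableSet A) [IsProbabilityMeasure G] (hGA : G.real A = 1 / 2) :
    law {P | (P : Measure ℝ).real A = 1 / 2} = 0 := by
  have hm : MeasurableSet {v : Fin 2 → ℝ | v 0 = 1 / 2} :=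
    measurableSet_eq_fun (by fun_prop) measurable_const
  have := h.map_pair hA hm
  rw [dirichlet_two_half] at this
  · exact this
  · intro i
    have hc : G.real Aᶜ = 1 / 2 := by rw [probReal_compl_eq_one_sub hA, hGA]; norm_num
    fin_cases i
    · simp [hGA, ha]
    · simp [hc, ha]

/-- The Riemann sum along a grid as a function of the probabilities of its cells. -/
noncomputable def stepSum (m : ℕ) (v : Fin m → ℝ) : ℝ :=
  (∑ j ∈ Finset.range m, ((∑ i : Fin m, if (i : ℕ) < j then v i else 0) - j / m) ^ 2) / m

lemma continuous_stepSum (m : ℕ) : Continuous (stepSum m) := by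
  unfold stepSum
  refine Continuous.div_const (continuous_finsetSum _ fun j _ => Continuous.pow (Continuous.sub
    (continuous_finsetSum _ fun i _ => ?_) continuous_const) 2) _
  split_ifs
  exacts [continuous_apply i, continuous_const]

lemma sum_fin_ite_lt {m j : ℕ} (hj : j < m) (u : ℕ → ℝ) :
    (∑ i : Fin m, if (i : ℕ) < j then u i else 0) = ∑ i ∈ Finset.range j, u i := by
  rw [Fin.sum_univ_eq_sum_range (fun i => if i < j then u i else 0) m, ← Finset.sum_filter]
  congr 1
  ext i
  simp only [Finset.mem_filter, Finset.mem_range]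
  omega

/-- The Dirichlet property concerns disjoint cells, whereas the grid is nested; each `E j` is the
union of its first `j` increments. -/
lemma gridSum_eq_stepSum {m : ℕ} {E : ℕ → Set ℝ} (hE : IsGrid m E) (P : Measure ℝ)
    [IsProbabilityMeasure P] :
    gridSum E m P = stepSum m fun i => P.real (E (i + 1) \ E i) := by
  unfold gridSum stepSum
  congr 1
  refine Finset.sum_congr rfl fun j hj => ?_
  rw [sum_fin_ite_lt (Finset.mem_range.1 hj) fun i => P.real (E (i + 1) \ E i)]
  have : ∀ i, P.real (E (i + 1) \ E i) = P.real (E (i + 1)) - P.real (E i) := fun i =>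
    measureReal_sdiff (hE.mono (Nat.le_succ i)) (hE.measurableSet i)
  simp_rw [this]
  rw [Finset.sum_range_sub fun i => P.real (E i), hE.zero]
  simp

/-- Equal masses reproduce `G` on its own quantile grid. They are written as the normalization of
the vector `1`, the witness for small distances. -/
lemma stepSum_uniform (m : ℕ) : stepSum m (fun _ => 1 / ∑ _j : Fin m, 1) = 0 := by
  unfold stepSum
  rw [Finset.sum_eq_zero, zero_div]
  intro j hj
  rw [sum_fin_ite_lt (Finset.mem_range.1 hj) fun _ => 1 / ∑ _j : Fin m, 1]
  simp [div_eq_mul_inv]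

/-- The distribution of a Riemann sum along a quantile grid depends only on the concentration
parameter. -/
lemma IsDirichletProcess.map_gridSum [IsProbabilityMeasure G] (h : IsDirichletProcess a G law)
    {m : ℕ} {E : ℕ → Set ℝ} (hE : IsGrid m E) (hEG : ∀ j ≤ m, G.real (E j) = j / m) :
    law.map (fun P : ProbabilityMeasure ℝ => gridSum E m (P : Measure ℝ)) =
      (dirichlet fun _ : Fin m => a * (1 / m)).map (stepSum m) := by
  have hmeas : ∀ i : Fin m, MeasurableSet (E (i + 1) \ E i) := fun i =>
    (hE.measurableSet _).diff (hE.measurableSet _)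
  have hD := h m (fun i => E (i + 1) \ E i) hmeas ?_ ?_
  · have hα : (fun i : Fin m => a * G.real (E (i + 1) \ E i)) = fun _ => a * (1 / m) := by
      ext i
      rw [measureReal_sdiff (hE.mono (Nat.le_succ _)) (hE.measurableSet _),
        hEG _ i.isLt, hEG _ i.isLt.le]
      push_cast
      ring
    rw [hα] at hD
    rw [← hD, Measure.map_map (continuous_stepSum m).measurable (measurable_real_vec hmeas)]
    congr 1
    ext P
    exact gridSum_eq_stepSum hE _
  · intro i j hij
    have key : ∀ i j : ℕ, i < j → Disjoint (E (i + 1) \ E i) (E (j + 1) \ E j) := by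
      intro i j hij
      rw [Set.disjoint_left]
      exact fun x hx hy => hy.2 (hE.mono hij hx.1)
    rcases lt_or_gt_of_ne (Fin.val_ne_of_ne hij) with hlt | hlt
    · exact key _ _ hlt
    · exact (key _ _ hlt).symm
  · refine eq_univ_of_forall fun x => ?_
    -- The least `j` with `x ∈ E j` is nonzero because `E 0 = ∅`, so `x` lies in the increment just
    -- before it.
    have hex : ∃ j, x ∈ E j := ⟨m, by rw [hE.top]; trivial⟩
    classical
    have hspec := Nat.find_spec hex
    have hle : Nat.find hex ≤ m := Nat.find_min' hex (by rw [hE.top]; trivial)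
    have h0 : Nat.find hex ≠ 0 := fun h0 => by rw [h0, hE.zero] at hspec; exact hspec
    obtain ⟨i, hi⟩ := Nat.exists_eq_succ_of_ne_zero h0
    refine mem_iUnion.2 ⟨⟨i, by omega⟩, ?_, Nat.find_min hex (m := i) (by omega)⟩
    rw [hi] at hspec
    exact hspec

/-- The distribution of the distance to a continuous base measure depends only on the
concentration parameter. -/
lemma map_cvm_eq {G₁ G₂ : Measure ℝ} [IsProbabilityMeasure G₁] [IsProbabilityMeasure G₂]
    (hG₁ : Continuous (cdf G₁)) (hG₂ : Continuous (cdf G₂))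
    {law₁ law₂ : Measure (ProbabilityMeasure ℝ)} (ha : 0 ≤ a)
    (h₁ : IsDirichletProcess a G₁ law₁) (h₂ : IsDirichletProcess a G₂ law₂) :
    law₁.map (fun P : ProbabilityMeasure ℝ => cvm (P : Measure ℝ) G₁) =
      law₂.map (fun P : ProbabilityMeasure ℝ => cvm (P : Measure ℝ) G₂) := by
  have hp₁ := h₁.isProbabilityMeasure ha
  have hp₂ := h₂.isProbabilityMeasure ha
  have := Measure.isProbabilityMeasure_map (μ := law₁) (measurable_cvm G₁ hG₁).aemeasurable
  have := Measure.isProbabilityMeasure_map (μ := law₂) (measurable_cvm G₂ hG₂).aemeasurable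
  choose E₁ hE₁ hEG₁ using fun m : ℕ => exists_quantile_grid G₁ hG₁ m.succ_pos
  choose E₂ hE₂ hEG₂ using fun m : ℕ => exists_quantile_grid G₂ hG₂ m.succ_pos
  refine ext_of_forall_integral_eq_of_IsFiniteMeasure fun f => ?_
  -- The law of the distance is the weak limit of a sequence of laws in which `G` no longer appears;
  -- the two limits must therefore agree.
  have hlim : ∀ (G : Measure ℝ) [IsProbabilityMeasure G] (hG : Continuous (cdf G))
      (law : Measure (ProbabilityMeasure ℝ)) [IsProbabilityMeasure law]
      (_ : IsDirichletProcess a G law) (E : ℕ → ℕ → Set ℝ) (_ : ∀ m, IsGrid (m + 1) (E m))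
      (_ : ∀ m, ∀ j ≤ m + 1, G.real (E m j) = j / (m + 1 : ℕ)),
      Tendsto (fun m : ℕ => ∫ x, f x ∂(dirichlet fun _ : Fin (m + 1) =>
        a * (1 / (m + 1 : ℕ))).map (stepSum (m + 1))) atTop
        (𝓝 (∫ x, f x ∂law.map (fun P : ProbabilityMeasure ℝ => cvm (P : Measure ℝ) G))) := by
    intro G _ hG law _ h E hE hEG
    rw [integral_map (measurable_cvm G hG).aemeasurable
      f.continuous.measurable.aestronglyMeasurable]
    have e : ∀ m : ℕ, ∫ x, f x ∂(dirichlet fun _ : Fin (m + 1) =>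
        a * (1 / (m + 1 : ℕ))).map (stepSum (m + 1)) =
        ∫ P : ProbabilityMeasure ℝ, f (gridSum (E m) (m + 1) (P : Measure ℝ)) ∂law := by
      intro m
      rw [← h.map_gridSum (hE m) (hEG m), integral_map (measurable_gridSum (hE m)).aemeasurable
        f.continuous.measurable.aestronglyMeasurable]
    simp_rw [e]
    refine tendsto_integral_of_dominated_convergence (fun _ => ‖f‖) (fun m => ?_)
      (integrable_const _) (fun m => ae_of_all _ fun P => f.norm_coe_le_norm _)
      (ae_of_all _ fun P => ?_)
    · exact (f.continuous.measurable.comp (measurable_gridSum (hE m))).aestronglyMeasurable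
    · exact (f.continuous.tendsto _).comp (tendsto_gridSum hE P G hEG)
  exact tendsto_nhds_unique (hlim G₁ hG₁ law₁ h₁ E₁ hE₁ hEG₁) (hlim G₂ hG₂ law₂ h₂ E₂ hE₂ hEG₂)

/-! ### The support of the law of the distance. -/

variable [IsProbabilityMeasure G]

/-- At a median of `G`, distance zero would force `P` to have mass exactly `1/2` to its left, but
this mass is a beta variable without an atom there. -/
lemma IsDirichletProcess.cvm_eq_zero_null (h : IsDirichletProcess a G law) (ha : 0 < a)
    (hG : Continuous (cdf G)) : law {P | cvm (P : Measure ℝ) G ≤ 0} = 0 := by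
  obtain ⟨q, hq⟩ := exists_cdf_eq G hG (p := 1 / 2) (by norm_num) (by norm_num)
  refine measure_mono_null (fun P hP => ?_)
    (h.real_eq_half_null ha (measurableSet_Iic (a := q)) (by rw [← cdf_eq_real, hq]))
  rw [mem_ofPred_eq, real_Iic_eq_of_cvm_eq_zero (P : Measure ℝ) G hG
    (le_antisymm hP (cvm_nonneg _ _)) (by rw [hq]; norm_num) (by rw [hq]; norm_num), hq]

lemma IsDirichletProcess.gridSum_mem_ne_zero (h : IsDirichletProcess a G law) (ha : 0 < a)
    {m : ℕ} (hm : 0 < m) {E : ℕ → Set ℝ} (hE : IsGrid m E)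
    (hEG : ∀ j ≤ m, G.real (E j) = j / m) {U : Set ℝ} (hU : IsOpen U) {z : Fin m → ℝ}
    (hz : ∀ i, 0 < z i) (hzU : stepSum m (fun i => z i / ∑ j, z j) ∈ U) :
    law {P | gridSum E m (P : Measure ℝ) ∈ U} ≠ 0 := by
  have hmap := h.map_gridSum hE hEG
  have e : law {P | gridSum E m (P : Measure ℝ) ∈ U} =
      (dirichlet fun _ : Fin m => a * (1 / m)) (stepSum m ⁻¹' U) := by
    rw [← Measure.map_apply (continuous_stepSum m).measurable hU.measurableSet, ← hmap,
      Measure.map_apply (measurable_gridSum hE) hU.measurableSet]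
    rfl
  rw [e]
  exact dirichlet_ne_zero_of_isOpen (fun _ => by positivity)
    (hU.preimage (continuous_stepSum m)) hz hm hzU

lemma IsDirichletProcess.exists_stepSum_mem (h : IsDirichletProcess a G law) (ha : 0 < a)
    {m : ℕ} (hm : 0 < m) {E : ℕ → Set ℝ} (hE : IsGrid m E)
    (hEG : ∀ j ≤ m, G.real (E j) = j / m) {U : Set ℝ} (hU : MeasurableSet U)
    (hne : law {P | gridSum E m (P : Measure ℝ) ∈ U} ≠ 0) :
    ∃ z : Fin m → ℝ, (∀ i, 0 < z i) ∧ stepSum m (fun i => z i / ∑ j, z j) ∈ U := by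
  have hmap := h.map_gridSum hE hEG
  have e : law {P | gridSum E m (P : Measure ℝ) ∈ U} =
      (dirichlet fun _ : Fin m => a * (1 / m)) (stepSum m ⁻¹' U) := by
    rw [← Measure.map_apply (continuous_stepSum m).measurable hU, ← hmap,
      Measure.map_apply (measurable_gridSum hE) hU]
    rfl
  rw [e] at hne
  exact exists_pos_of_dirichlet_ne_zero (fun _ => by positivity)
    ((continuous_stepSum m).measurable hU) hne

lemma exists_four_div_lt {δ : ℝ} (hδ : 0 < δ) : ∃ m : ℕ, 0 < m ∧ (4 : ℝ) / m < δ := by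
  have h := (tendsto_const_div_atTop_nhds_zero_nat (4 : ℝ)).eventually (gt_mem_nhds hδ)
  obtain ⟨m, hm, hm'⟩ := (h.and (eventually_gt_atTop 0)).exists
  exact ⟨m, hm', hm⟩

/-- Every neighbourhood of the base measure has positive probability. -/
lemma IsDirichletProcess.cvm_lt_ne_zero (h : IsDirichletProcess a G law) (ha : 0 < a)
    (hG : Continuous (cdf G)) {δ : ℝ} (hδ : 0 < δ) :
    law {P | cvm (P : Measure ℝ) G < δ} ≠ 0 := by
  obtain ⟨m, hm, hmδ⟩ := exists_four_div_lt (half_pos hδ)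
  obtain ⟨E, hE, hEG⟩ := exists_quantile_grid G hG hm
  have := h.gridSum_mem_ne_zero ha hm hE hEG (isOpen_Iio (a := δ / 2)) (z := fun _ => 1)
    (fun _ => one_pos) (by rw [stepSum_uniform]; exact half_pos hδ)
  refine fun h0 => this (measure_mono_null (fun P hP => ?_) h0)
  have hP : gridSum E m (P : Measure ℝ) < δ / 2 := hP
  have := abs_le.1 (abs_cvm_sub_gridSum_le_of_quantile hm hE (P : Measure ℝ) G hEG)
  show cvm (P : Measure ℝ) G < δ
  linarith

/-- The support of the distribution of the distance has no gaps. -/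
lemma IsDirichletProcess.cvm_Ioo_ne_zero (h : IsDirichletProcess a G law) (ha : 0 < a)
    (hG : Continuous (cdf G)) {c₁ c₂ : ℝ} (hc : c₁ < c₂)
    (h₁ : law {P | cvm (P : Measure ℝ) G ≤ c₁} ≠ 0)
    (h₂ : law {P | c₂ ≤ cvm (P : Measure ℝ) G} ≠ 0) :
    law {P | cvm (P : Measure ℝ) G ∈ Ioo c₁ c₂} ≠ 0 := by
  -- Passing between distance and grid sum costs less than a quarter of the gap, so grid sums in the
  -- middle half come from distances inside `(c₁, c₂)`.
  obtain ⟨m, hm, hmδ⟩ := exists_four_div_lt (by linarith : 0 < (c₂ - c₁) / 4)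
  obtain ⟨E, hE, hEG⟩ := exists_quantile_grid G hG hm
  have happ := fun P : ProbabilityMeasure ℝ =>
    abs_le.1 (abs_cvm_sub_gridSum_le_of_quantile hm hE (P : Measure ℝ) G hEG)
  obtain ⟨z₁, hz₁, hs₁⟩ := h.exists_stepSum_mem ha hm hE hEG
    (measurableSet_Iic (a := c₁ + (c₂ - c₁) / 4)) fun h0 => h₁ (measure_mono_null (fun P hP => by
      have hP : cvm (P : Measure ℝ) G ≤ c₁ := hP
      show gridSum E m (P : Measure ℝ) ≤ _
      linarith [(happ P).1]) h0)
  obtain ⟨z₂, hz₂, hs₂⟩ := h.exists_stepSum_mem ha hm hE hEG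
    (measurableSet_Ici (a := c₂ - (c₂ - c₁) / 4)) fun h0 => h₂ (measure_mono_null (fun P hP => by
      have hP : c₂ ≤ cvm (P : Measure ℝ) G := hP
      show _ ≤ gridSum E m (P : Measure ℝ)
      linarith [(happ P).2]) h0)
  have : NeZero m := ⟨hm.ne'⟩
  have hconv : Convex ℝ (univ.pi fun _ : Fin m => Ioi (0 : ℝ)) :=
    convex_pi fun _ _ => convex_Ioi 0
  have hcont : ContinuousOn (fun z : Fin m → ℝ => stepSum m (fun i => z i / ∑ j, z j))
      (univ.pi fun _ : Fin m => Ioi (0 : ℝ)) := by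
    refine (continuous_stepSum m).comp_continuousOn (continuousOn_pi.2 fun i => ?_)
    refine ContinuousOn.div (continuous_apply i).continuousOn
      (continuous_finsetSum _ fun j _ => continuous_apply j).continuousOn fun z hz => ?_
    exact (Finset.sum_pos (fun i _ => hz i trivial) Finset.univ_nonempty).ne'
  have hs₁ : stepSum m (fun i => z₁ i / ∑ j, z₁ j) ≤ c₁ + (c₂ - c₁) / 4 := hs₁
  have hs₂ : c₂ - (c₂ - c₁) / 4 ≤ stepSum m (fun i => z₂ i / ∑ j, z₂ j) := hs₂
  -- The positive orthant is connected, so the grid sum attains the midpoint of the gap at a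
  -- positive vector; nearby vectors then have positive probability.
  obtain ⟨z, hz, hzs⟩ := hconv.isPreconnected.intermediate_value (a := z₁) (b := z₂)
    (fun i _ => hz₁ i) (fun i _ => hz₂ i) hcont
    (show (c₁ + c₂) / 2 ∈ _ from ⟨by linarith, by linarith⟩)
  have := h.gridSum_mem_ne_zero ha hm hE hEG
    (isOpen_Ioo (a := c₁ + (c₂ - c₁) / 4) (b := c₂ - (c₂ - c₁) / 4)) (z := z)
    (fun i => hz i trivial) (by
      simp only at hzs
      rw [hzs]; constructor <;> linarith)
  refine fun h0 => this (measure_mono_null (fun P hP => ?_) h0)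
  have hP : gridSum E m (P : Measure ℝ) ∈ Ioo _ _ := hP
  exact ⟨by linarith [hP.1, (happ P).1], by linarith [hP.2, (happ P).2]⟩

end DirichletProcess

/-! ### Concentration of the posterior -/

lemma posteriorBase_real_apply {a : ℝ} (ha : 0 < a) (H : Measure ℝ) [IsProbabilityMeasure H]
    {n : ℕ} (hn : 0 < n) (x : Fin n → ℝ) {A : Set ℝ} (hA : MeasurableSet A) :
    (posteriorBase a H x).real A =
      a / (a + n) * H.real A + n / (a + n) * ((∑ i, A.indicator 1 (x i)) / n) := by
  have hn' : (0 : ℝ) < n := by exact_mod_cast hn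
  have he : (empirical x).real A = (∑ i, A.indicator 1 (x i)) / n := by
    rw [empirical, measureReal_ennreal_smul_apply, measureReal_def, Measure.finsetSum_apply,
      ENNReal.toReal_sum (fun i _ => measure_ne_top _ _)]
    simp_rw [Measure.dirac_apply' _ hA]
    rw [ENNReal.toReal_inv, ENNReal.toReal_natCast, div_eq_inv_mul]
    congr 1
    refine Finset.sum_congr rfl fun i _ => ?_
    by_cases h : x i ∈ A <;> simp [h]
  have hfin : empirical x A ≠ ⊤ := by
    rw [empirical, Measure.smul_apply, Measure.finsetSum_apply, smul_eq_mul]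
    exact ENNReal.mul_ne_top (by simp [hn.ne'])
      (ENNReal.sum_ne_top.2 fun i _ => measure_ne_top _ _)
  rw [posteriorBase, measureReal_add_apply (by simp [ENNReal.mul_eq_top])
    (by rw [Measure.smul_apply, smul_eq_mul]; exact ENNReal.mul_ne_top ENNReal.ofReal_ne_top hfin),
    measureReal_ennreal_smul_apply, measureReal_ennreal_smul_apply,
    ENNReal.toReal_ofReal (by positivity), ENNReal.toReal_ofReal (by positivity), he]

lemma isProbabilityMeasure_posteriorBase {a : ℝ} (ha : 0 < a) (H : Measure ℝ)
    [IsProbabilityMeasure H] {n : ℕ} (hn : 0 < n) (x : Fin n → ℝ) :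
    IsProbabilityMeasure (posteriorBase a H x) := by
  have hn' : (0 : ℝ) < n := by exact_mod_cast hn
  have h := posteriorBase_real_apply ha H hn x MeasurableSet.univ
  have h1 : (posteriorBase a H x).real univ = 1 := by
    rw [h]
    simp only [indicator_univ, Pi.one_apply, Finset.sum_const, Finset.card_univ, Fintype.card_fin,
      nsmul_eq_mul, mul_one, probReal_univ]
    field_simp
  refine ⟨?_⟩
  rw [measureReal_def] at h1
  exact (ENNReal.toReal_eq_one_iff _).1 h1

/-- The strong law of large numbers for the frequency of an event. -/
lemma ae_tendsto_frequency {Ω : Type*} [MeasurableSpace Ω] {ν : Measure Ω}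
    [IsProbabilityMeasure ν] {Q : Measure ℝ} {X : ℕ → Ω → ℝ} (hXindep : iIndepFun X ν)
    (hXlaw : ∀ i, HasLaw (X i) Q ν) {A : Set ℝ} (hA : MeasurableSet A) :
    ∀ᵐ ω ∂ν, Tendsto (fun n : ℕ => (∑ i : Fin n, A.indicator (1 : ℝ → ℝ) (X i ω)) / n) atTop
      (𝓝 (Q.real A)) := by
  have hm : Measurable (A.indicator (1 : ℝ → ℝ)) := measurable_one.indicator hA
  have hident : ∀ i, IdentDistrib (X i) (X 0) ν ν := fun i =>
    ⟨(hXlaw i).aemeasurable, (hXlaw 0).aemeasurable, by rw [(hXlaw i).map_eq, (hXlaw 0).map_eq]⟩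
  have h := strong_law_ae_real (μ := ν) (fun i ω => A.indicator (1 : ℝ → ℝ) (X i ω)) ?_ ?_ ?_
  · have hE : ∫ ω, A.indicator (1 : ℝ → ℝ) (X 0 ω) ∂ν = Q.real A := by
      rw [← integral_map (f := A.indicator (1 : ℝ → ℝ)) (hXlaw 0).aemeasurable
        hm.aestronglyMeasurable, (hXlaw 0).map_eq, integral_indicator_one hA]
    filter_upwards [h] with ω hω
    rw [hE] at hω
    refine hω.congr fun n => ?_
    rw [Fin.sum_univ_eq_sum_range (fun i => A.indicator (1 : ℝ → ℝ) (X i ω))]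
  · refine Integrable.of_bound (C := 1)
      (hm.comp_aemeasurable (hXlaw 0).aemeasurable).aestronglyMeasurable (ae_of_all _ fun ω => ?_)
    by_cases h : X 0 ω ∈ A <;> simp [h]
  · exact fun i j hij => (hXindep.indepFun hij).comp hm hm
  · exact fun i => (hident i).comp hm

/-- The base measure of the posterior converges to the true distribution on an event on which the
frequencies do. -/
lemma tendsto_posteriorBase {a : ℝ} (ha : 0 < a) (H : ℕ → Measure ℝ)
    [∀ n, IsProbabilityMeasure (H n)] (x : ℕ → ℝ) {A : Set ℝ} (hA : MeasurableSet A) {q : ℝ}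
    (hfreq : Tendsto (fun n : ℕ => (∑ i : Fin n, A.indicator (1 : ℝ → ℝ) (x i)) / n) atTop (𝓝 q)) :
    Tendsto (fun n : ℕ => (posteriorBase a (H n) fun i : Fin n => x i).real A) atTop (𝓝 q) := by
  have hinf : Tendsto (fun n : ℕ => a + (n : ℝ)) atTop atTop :=
    tendsto_atTop_add_const_left _ _ tendsto_natCast_atTop_atTop
  have hw : Tendsto (fun n : ℕ => a / (a + n)) atTop (𝓝 0) := hinf.const_div_atTop a
  have hw' : Tendsto (fun n : ℕ => (n : ℝ) / (a + n)) atTop (𝓝 1) := by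
    have : Tendsto (fun n : ℕ => 1 - a / (a + n)) atTop (𝓝 (1 - 0)) := hw.const_sub 1
    rw [sub_zero] at this
    refine this.congr fun n => ?_
    have : a + (n : ℝ) ≠ 0 := by positivity
    field_simp
    ring
  -- `H n` may vary arbitrarily with the sample: its weight vanishes and its masses are bounded by
  -- `1`.
  have h1 : Tendsto (fun n : ℕ => a / (a + n) * (H n).real A) atTop (𝓝 0) := by
    refine squeeze_zero (fun n => mul_nonneg (by positivity) measureReal_nonneg) (fun n => ?_) hw
    exact mul_le_of_le_one_right (by positivity) measureReal_le_one
  have h2 := h1.add (hw'.mul hfreq)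
  rw [zero_add, one_mul] at h2
  refine h2.congr' ?_
  filter_upwards [eventually_gt_atTop 0] with n hn
  rw [posteriorBase_real_apply ha (H n) hn _ hA]

/-- Dirichlet processes with growing concentration parameters concentrate at the limit of their
base measures. -/
lemma tendsto_deviation {s : ℕ → ℝ} (hs : Tendsto s atTop atTop) {H : ℕ → Measure ℝ}
    (hH : ∀ᶠ n in atTop, IsProbabilityMeasure (H n))
    {L : ℕ → Measure (ProbabilityMeasure ℝ)}
    (hL : ∀ n, IsDirichletProcess (s n) (H n) (L n)) {A : Set ℝ} (hA : MeasurableSet A) {q : ℝ}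
    (hq : Tendsto (fun n => (H n).real A) atTop (𝓝 q)) {η : ℝ} (hη : 0 < η) :
    Tendsto (fun n => L n {P | η < |(P : Measure ℝ).real A - q|}) atTop (𝓝 0) := by
  -- `2η' ≤ η/2` leaves the other half of `η` for the error of the base measure; `1/4` is the range
  -- of the beta bound.
  set η' : ℝ := min (η / 4) (1 / 4) with hη'
  have hη'0 : 0 < η' := lt_min (by positivity) (by norm_num)
  have hη'1 : η' ≤ η / 4 := min_le_left _ _
  have hb : Tendsto (fun n => ENNReal.ofReal (1 / (η' ^ 2 * s n))) atTop (𝓝 0) := by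
    rw [← ENNReal.ofReal_zero]
    exact ENNReal.tendsto_ofReal
      ((hs.const_mul_atTop (by positivity : 0 < η' ^ 2)).const_div_atTop 1)
  refine tendsto_of_tendsto_of_tendsto_of_le_of_le' tendsto_const_nhds hb
    (Eventually.of_forall fun _ => zero_le) ?_
  filter_upwards [hH, hs.eventually_gt_atTop 0, Metric.tendsto_nhds.1 hq (η / 2) (by positivity)]
    with n hn hsn hqn
  refine (measure_mono fun P hP => ?_).trans ((hL n).deviation hsn hA hη'0 (min_le_right _ _))
  have hP : η < |(P : Measure ℝ).real A - q| := hP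
  rw [Real.dist_eq] at hqn
  show 2 * η' < |(P : Measure ℝ).real A - (H n).real A|
  have := abs_sub_le ((P : Measure ℝ).real A) ((H n).real A) q
  linarith

lemma abs_gridSum_sub_gridSum_le {m : ℕ} (hm : 0 < m) (E : ℕ → Set ℝ) (P Q : Measure ℝ)
    [IsProbabilityMeasure P] [IsProbabilityMeasure Q] {η : ℝ}
    (h : ∀ j < m, |P.real (E j) - Q.real (E j)| ≤ η) :
    |gridSum E m P - gridSum E m Q| ≤ 2 * η := by
  have hm' : (0 : ℝ) < m := by exact_mod_cast hm
  rw [gridSum, gridSum, ← sub_div, abs_div, abs_of_pos hm', div_le_iff₀ hm',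
    ← Finset.sum_sub_distrib]
  refine (Finset.abs_sum_le_sum_abs _ _).trans ?_
  calc _ ≤ ∑ j ∈ Finset.range m, 2 * η := by
        refine Finset.sum_le_sum fun j hj => ?_
        have hj := Finset.mem_range.1 hj
        have hjI : (j : ℝ) / m ∈ Icc (0 : ℝ) 1 :=
          ⟨by positivity, (div_le_one hm').2 (by exact_mod_cast hj.le)⟩
        have := abs_sq_sub_sq_le (x := P.real (E j)) (a := Q.real (E j))
          ⟨measureReal_nonneg, measureReal_le_one⟩ hjI
          ⟨measureReal_nonneg, measureReal_le_one⟩ hjI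
        rw [sub_self, abs_zero, mul_zero, add_zero] at this
        linarith [h j hj]
    _ = _ := by rw [Finset.sum_const, Finset.card_range, nsmul_eq_mul]; ring

/-- Every set of a grid is trivial or a half-line, so uniform closeness of the cdfs is enough. -/
lemma abs_real_sub_le_of_cdf {m : ℕ} {E : ℕ → Set ℝ} (hE : IsGrid m E) (G G' : Measure ℝ)
    [IsProbabilityMeasure G] [IsProbabilityMeasure G'] {ε : ℝ}
    (h : ∀ z, |cdf G z - cdf G' z| ≤ ε) (j : ℕ) : |G.real (E j) - G'.real (E j)| ≤ ε := by
  have hε : 0 ≤ ε := (abs_nonneg _).trans (h 0)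
  rcases hE.form j with e | e | ⟨q, e⟩ <;> rw [e]
  · simpa using hε
  · simpa using hε
  · rw [← cdf_eq_real, ← cdf_eq_real]
    exact h q

/-- If random distributions concentrate at `Q` on the cells of all grids of quantiles of `G₀` and
`Gₙ → G₀` uniformly, then their distance to `Gₙ` concentrates at the distance from `Q` to `G₀`. -/
lemma tendsto_cvm_deviation {G₀ Q : Measure ℝ} [IsProbabilityMeasure G₀] [IsProbabilityMeasure Q]
    {G : ℕ → Measure ℝ} [∀ n, IsProbabilityMeasure (G n)]
    (hG : TendstoUniformly (fun n z => cdf (G n) z) (fun z => cdf G₀ z) atTop)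
    {E : ℕ → ℕ → Set ℝ} (hE : ∀ m, IsGrid (m + 1) (E m))
    (hEG : ∀ m, ∀ j ≤ m + 1, G₀.real (E m j) = j / (m + 1 : ℕ))
    {L : ℕ → Measure (ProbabilityMeasure ℝ)}
    (hL : ∀ m j, ∀ η : ℝ, 0 < η →
      Tendsto (fun n => L n {P | η < |(P : Measure ℝ).real (E m j) - Q.real (E m j)|}) atTop (𝓝 0))
    {δ : ℝ} (hδ : 0 < δ) :
    Tendsto (fun n => L n {P | δ ≤ |cvm (P : Measure ℝ) (G n) - cvm Q G₀|}) atTop (𝓝 0) := by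
  -- Error budget: less than `δ/8 + δ/8` from `D(P)` to its grid sum, `2 · δ/8` from `P` to `Q` on
  -- the grid, less than `δ/8` from there to the limit; in all below `5δ/8`. The grid is fixed
  -- first, since `ε` depends on `m`.
  obtain ⟨m', hm', hmδ⟩ := exists_four_div_lt (by positivity : 0 < δ / 8)
  obtain ⟨m, rfl⟩ := Nat.exists_eq_succ_of_ne_zero hm'.ne'
  rw [Nat.succ_eq_add_one] at hmδ
  set ε : ℝ := δ / 8 / (10 + 2 * (m + 1 : ℕ)) with hεdef
  have hε : 0 < ε := by positivity
  have hεm : 10 * ε + 2 * (m + 1 : ℕ) * ε = δ / 8 := by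
    rw [hεdef]; field_simp
  have hQ := abs_le.1
    (abs_cvm_sub_gridSum_le_of_quantile m.succ_pos (hE m) Q G₀ (hEG m))
  have hsum : Tendsto (fun n => ∑ j ∈ Finset.range (m + 1),
      L n {P | δ / 8 < |(P : Measure ℝ).real (E m j) - Q.real (E m j)|}) atTop (𝓝 0) := by
    have := tendsto_finsetSum (Finset.range (m + 1)) fun j _ => hL m j (δ / 8) (by positivity)
    simpa using this
  refine tendsto_of_tendsto_of_tendsto_of_le_of_le' tendsto_const_nhds hsum
    (Eventually.of_forall fun _ => zero_le) ?_
  filter_upwards [Metric.tendstoUniformly_iff.1 hG ε hε] with n hn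
  refine (measure_mono fun P hP => ?_).trans (measure_biUnion_finset_le _ _)
  by_contra hcon
  simp only [Finset.mem_range, mem_iUnion, mem_ofPred_eq, exists_prop, not_exists, not_and,
    not_lt] at hcon
  have hP : δ ≤ |cvm (P : Measure ℝ) (G n) - cvm Q G₀| := hP
  have h1 := abs_le.1 (abs_gridSum_sub_gridSum_le m.succ_pos (E m) (P : Measure ℝ) Q hcon)
  have h2 := abs_le.1 (abs_cvm_sub_gridSum_le m.succ_pos (hE m) (P : Measure ℝ) (G n) (ε := ε)
    fun j hj => by
      rw [Nat.succ_eq_add_one, ← hEG m j hj]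
      refine abs_real_sub_le_of_cdf (hE m) (G n) G₀ (fun z => ?_) j
      rw [abs_sub_comm]
      exact (hn z).le)
  rw [Nat.succ_eq_add_one] at h1 h2 hQ
  refine absurd hP (not_le.2 (abs_lt.2 ⟨?_, ?_⟩)) <;> linarith [h1.1, h1.2, h2.1, h2.2, hQ.1, hQ.2]

/-- The posterior distribution of the distance is consistent. -/
theorem ae_tendsto_posterior_deviation {Θ Ω : Type*} [MeasurableSpace Ω] {ν : Measure Ω}
    [IsProbabilityMeasure ν] {F : Θ → ProbabilityMeasure ℝ}
    (hF : ∀ θ, Continuous (cdf (F θ : Measure ℝ))) {Ptrue : ProbabilityMeasure ℝ}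
    {X : ℕ → Ω → ℝ} (hXindep : iIndepFun X ν) (hXlaw : ∀ i, HasLaw (X i) (Ptrue : Measure ℝ) ν)
    {θ₀ : Θ} {est : (n : ℕ) → (Fin n → ℝ) → Θ}
    (hest : ∀ᵐ ω ∂ν, TendstoUniformly
      (fun n z => cdf (F (est n fun i => X i ω) : Measure ℝ) z)
      (fun z => cdf (F θ₀ : Measure ℝ) z) atTop)
    {a : ℝ} (ha : 0 < a) {post : (n : ℕ) → (Fin n → ℝ) → Measure (ProbabilityMeasure ℝ)}
    (hpost : ∀ (n : ℕ) (x : Fin n → ℝ), IsDirichletProcess (a + n)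
      (posteriorBase a (F (est n x) : Measure ℝ) x) (post n x)) :
    ∀ᵐ ω ∂ν, ∀ δ : ℝ, 0 < δ → Tendsto (fun n => post n (fun i => X i ω)
      {P | δ ≤ |cvm (P : Measure ℝ) (F (est n fun i => X i ω) : Measure ℝ) -
        cvm (Ptrue : Measure ℝ) (F θ₀ : Measure ℝ)|}) atTop (𝓝 0) := by
  choose E hE hEG using fun m : ℕ =>
    exists_quantile_grid (F θ₀ : Measure ℝ) (hF θ₀) m.succ_pos
  -- The grids use only countably many half-lines, so one null set serves for all of them and for
  -- every `δ`.
  have hfreq : ∀ᵐ ω ∂ν, ∀ m j, Tendsto (fun n : ℕ =>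
      (∑ i : Fin n, (E m j).indicator (1 : ℝ → ℝ) (X i ω)) / n) atTop
      (𝓝 ((Ptrue : Measure ℝ).real (E m j))) :=
    ae_all_iff.2 fun m => ae_all_iff.2 fun j =>
      ae_tendsto_frequency hXindep hXlaw ((hE m).measurableSet j)
  filter_upwards [hfreq, hest] with ω hω hestω δ hδ
  refine tendsto_cvm_deviation hestω hE hEG (fun m j η hη => ?_) hδ
  refine tendsto_deviation (s := fun n => a + n)
    (tendsto_atTop_add_const_left _ _ tendsto_natCast_atTop_atTop) ?_
    (fun n => hpost n _) ((hE m).measurableSet j) ?_ hη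
  · filter_upwards [eventually_gt_atTop 0] with n hn
    exact isProbabilityMeasure_posteriorBase ha _ hn _
  · exact tendsto_posteriorBase ha (fun n => (F (est n fun i => X i ω) : Measure ℝ))
      (fun i => X i ω) ((hE m).measurableSet j) (hω m j)
/-! ### The cells of the discretization -/

section Cells

variable {a : ℝ} {G : ProbabilityMeasure ℝ} {law : Measure (ProbabilityMeasure ℝ)}

lemma probD_eq_map (hG : Continuous (cdf (G : Measure ℝ))) {C : Set ℝ} (hC : MeasurableSet C) :
    probD law G C =
      (law.map fun P : ProbabilityMeasure ℝ => cvm (P : Measure ℝ) (G : Measure ℝ)).real C := by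
  rw [map_measureReal_apply (measurable_cvm _ hG) hC]
  rfl

lemma quantileD_eq_quantile (hG : Continuous (cdf (G : Measure ℝ))) (q : ℝ) :
    quantileD law G q = quantile
      (law.map fun P : ProbabilityMeasure ℝ => cvm (P : Measure ℝ) (G : Measure ℝ)) q := by
  simp_rw [quantileD, quantile, probD_eq_map hG measurableSet_Iic]

lemma measurableSet_nullCell (M i₀ : ℕ) : MeasurableSet (nullCell law G M i₀) :=
  measurableSet_Ico

lemma measurableSet_cell (M i : ℕ) : MeasurableSet (cell law G M i) := by
  unfold cell
  split_ifs
  exacts [measurableSet_Ico, measurableSet_Ici]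

lemma probD_mono [IsFiniteMeasure law] {C C' : Set ℝ} (h : C ⊆ C') :
    probD law G C ≤ probD law G C' :=
  measureReal_mono fun _ hP => h hP

lemma relBelief_nonneg {prior post : Measure (ProbabilityMeasure ℝ)} (C : Set ℝ) :
    0 ≤ relBelief prior post G C :=
  div_nonneg measureReal_nonneg measureReal_nonneg

lemma natCast_div_mem_Ioo {M i : ℕ} (hi : 0 < i) (hiM : i < M) :
    ((i : ℝ) / M) ∈ Ioo (0 : ℝ) 1 := by
  have hM : (0 : ℝ) < M := by exact_mod_cast hi.trans hiM
  exact ⟨div_pos (by exact_mod_cast hi) hM, (div_lt_one hM).2 (by exact_mod_cast hiM)⟩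

/-- The prior gives `{D ≤ 0}` probability zero, but `{D ≤ d_p}` probability at least `p > 0`. -/
lemma quantileD_pos (h : IsDirichletProcess a (G : Measure ℝ) law) (ha : 0 < a)
    (hG : Continuous (cdf (G : Measure ℝ))) {p : ℝ} (h0 : 0 < p) (h1 : p < 1) :
    0 < quantileD law G p := by
  have := h.isProbabilityMeasure ha.le
  have := Measure.isProbabilityMeasure_map (μ := law) (measurable_cvm _ hG).aemeasurable
  by_contra! hle
  have hq := le_real_Iic_quantile
    (μ := law.map fun P : ProbabilityMeasure ℝ => cvm (P : Measure ℝ) (G : Measure ℝ)) h1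
  rw [← quantileD_eq_quantile hG, ← probD_eq_map hG measurableSet_Iic] at hq
  have h2 : probD law G (Iic (quantileD law G p)) ≤ probD law G (Iic 0) :=
    probD_mono (Iic_subset_Iic.2 hle)
  have h3 : probD law G (Iic 0) = 0 := by
    rw [probD, measureReal_def]
    exact (ENNReal.toReal_eq_zero_iff _).2 (Or.inl (h.cvm_eq_zero_null ha hG))
  linarith

lemma probD_nullCell_pos (h : IsDirichletProcess a (G : Measure ℝ) law) (ha : 0 < a)
    (hG : Continuous (cdf (G : Measure ℝ))) {M i₀ : ℕ} (hi₀ : 0 < i₀) (hi₀M : i₀ < M) :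
    0 < probD law G (nullCell law G M i₀) := by
  have := h.isProbabilityMeasure ha.le
  have hp := natCast_div_mem_Ioo hi₀ hi₀M
  have hpos := h.cvm_lt_ne_zero ha hG (quantileD_pos h ha hG hp.1 hp.2)
  refine measureReal_nonneg.lt_of_ne' fun h0 => hpos ?_
  rw [measureReal_eq_zero_iff] at h0
  refine measure_mono_null (fun P hP => ?_) h0
  exact ⟨cvm_nonneg _ _, hP⟩

/-- Every non-empty cell of the discretization has positive prior probability. -/
lemma cell_eq_empty_or_probD_pos (h : IsDirichletProcess a (G : Measure ℝ) law) (ha : 0 < a)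
    (hG : Continuous (cdf (G : Measure ℝ))) {M i : ℕ} (hi : 0 < i) (hiM : i < M) :
    cell law G M i = ∅ ∨ 0 < probD law G (cell law G M i) := by
  have := h.isProbabilityMeasure ha.le
  have := Measure.isProbabilityMeasure_map (μ := law) (measurable_cvm _ hG).aemeasurable
  have hIci : ∀ j : ℕ, 0 < j → j < M → 0 < probD law G (Ici (quantileD law G (j / M))) := by
    intro j hj hjM
    have hp := natCast_div_mem_Ioo hj hjM
    have hq := real_Iio_quantile_le
      (μ := law.map fun P : ProbabilityMeasure ℝ => cvm (P : Measure ℝ) (G : Measure ℝ)) hp.1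
    rw [probD_eq_map hG measurableSet_Ici, ← compl_Iio, probReal_compl_eq_one_sub measurableSet_Iio,
      quantileD_eq_quantile hG]
    linarith [hp.2]
  unfold cell
  split_ifs with hlt
  · rcases le_or_gt (quantileD law G ((i + 1 : ℕ) / M)) (quantileD law G (i / M)) with hle | hgt
    · exact Or.inl (Ico_eq_empty (not_lt.2 hle))
    right
    have hp := natCast_div_mem_Ioo hi hiM
    have hq := le_real_Iic_quantile
      (μ := law.map fun P : ProbabilityMeasure ℝ => cvm (P : Measure ℝ) (G : Measure ℝ)) hp.2
    rw [← quantileD_eq_quantile hG, ← probD_eq_map hG measurableSet_Iic] at hq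
    have hne := h.cvm_Ioo_ne_zero ha hG hgt
      (fun h0 => (hp.1.trans_le hq).ne' ((measureReal_eq_zero_iff).2 h0))
      (fun h0 => (hIci (i + 1) i.succ_pos hlt).ne' ((measureReal_eq_zero_iff).2 h0))
    refine measureReal_nonneg.lt_of_ne' fun h0 => hne ?_
    rw [measureReal_eq_zero_iff] at h0
    refine measure_mono_null (fun P hP => ?_) h0
    exact ⟨hP.1.le, hP.2⟩
  · exact Or.inr (hIci i hi hiM)

/-- The strength is small if the relative belief ratio of the null cell is. -/
lemma strength_le {prior post : Measure (ProbabilityMeasure ℝ)} [IsProbabilityMeasure prior]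
    [IsProbabilityMeasure post] {M i₀ : ℕ}
    (hcell : ∀ i ∈ Finset.Ico i₀ M, cell prior G M i = ∅ ∨ 0 < probD prior G (cell prior G M i)) :
    strength prior post G M i₀ ≤ probD post G (nullCell prior G M i₀) +
      M * relBelief prior post G (nullCell prior G M i₀) := by
  set r := relBelief prior post G (nullCell prior G M i₀) with hr
  have hr0 : 0 ≤ r := relBelief_nonneg _
  set S : ℕ → Set (ProbabilityMeasure ℝ) := fun i =>
    {P | cvm (P : Measure ℝ) (G : Measure ℝ) ∈ cell prior G M i ∧
      relBelief prior post G (cell prior G M i) ≤ r} with hS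
  have hsub : {P : ProbabilityMeasure ℝ | cvm (P : Measure ℝ) (G : Measure ℝ) ∈
      {d | ∃ C ∈ cells prior G M i₀, d ∈ C ∧ relBelief prior post G C ≤ r}} ⊆
      {P | cvm (P : Measure ℝ) (G : Measure ℝ) ∈ nullCell prior G M i₀} ∪
        ⋃ i ∈ Finset.Ico i₀ M, S i := by
    rintro P ⟨C, hC, hPC, hCr⟩
    rcases hC with rfl | ⟨i, hi, rfl⟩
    · exact Or.inl hPC
    · exact Or.inr (mem_biUnion (Finset.mem_coe.2 (Finset.mem_Ico.2 hi)) ⟨hPC, hCr⟩)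
  have hterm : ∀ i ∈ Finset.Ico i₀ M, post.real (S i) ≤ r := by
    intro i hi
    -- A non-empty cell of prior mass zero would have ratio `0` by the convention for division and
    -- always be counted, with no control on its posterior mass; the hypothesis excludes this.
    rcases hcell i hi with he | hpos
    · have : S i = ∅ := by
        ext P; simp [hS, he]
      rw [this]
      simpa using hr0
    by_cases hle : relBelief prior post G (cell prior G M i) ≤ r
    · have h1 : post.real (S i) ≤ probD post G (cell prior G M i) :=
        measureReal_mono fun P hP => hP.1
      have h2 : probD post G (cell prior G M i) ≤ r * probD prior G (cell prior G M i) :=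
        (div_le_iff₀ hpos).1 hle
      have h3 : probD prior G (cell prior G M i) ≤ 1 := measureReal_le_one
      nlinarith
    · have : S i = ∅ := by
        ext P; simp [hS, hle]
      rw [this]
      simpa using hr0
  calc strength prior post G M i₀ ≤ post.real _ := measureReal_mono hsub
    _ ≤ _ + _ := measureReal_union_le _ _
    _ ≤ _ := by
      refine add_le_add le_rfl ((measureReal_biUnion_finset_le _ _).trans
        ((Finset.sum_le_sum hterm).trans ?_))
      rw [Finset.sum_const, Nat.card_Ico, nsmul_eq_mul]
      exact mul_le_mul_of_nonneg_right (by exact_mod_cast Nat.sub_le _ _) hr0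

lemma probD_nullCell_le_strength {prior post : Measure (ProbabilityMeasure ℝ)}
    [IsFiniteMeasure post] {M i₀ : ℕ} :
    probD post G (nullCell prior G M i₀) ≤ strength prior post G M i₀ :=
  probD_mono fun _ hd => ⟨_, mem_insert _ _, hd, le_rfl⟩

end Cells

end ModelCheck

/-! ### Limits of the relative belief ratios and of the strength. -/

theorem proposition1 {Θ Ω : Type*} [MeasurableSpace Ω] (ν : Measure Ω) [IsProbabilityMeasure ν]
    -- the model: continuous distributions on the line
    (F : Θ → ProbabilityMeasure ℝ) (hF : ∀ θ, Continuous (cdf (F θ : Measure ℝ)))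
    -- the data: an i.i.d. sequence from the true distribution
    (Ptrue : ProbabilityMeasure ℝ) (X : ℕ → Ω → ℝ) (hXindep : iIndepFun X ν)
    (hXlaw : ∀ i, HasLaw (X i) (Ptrue : Measure ℝ) ν)
    -- `θ₀` gives the true distribution if some parameter does, as does every minimizer of a
    -- divergence from the true distribution
    (θ₀ : Θ) (hθ₀ : (∃ θ, Ptrue = F θ) → Ptrue = F θ₀)
    -- the estimator `θ(x)`, with `sup_z |F_{θ(x)}(z) - F_{θ₀}(z)| → 0` almost surely
    (est : (n : ℕ) → (Fin n → ℝ) → Θ)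
    (hest : ∀ᵐ ω ∂ν, TendstoUniformly
      (fun n z => cdf (F (est n fun i => X i ω) : Measure ℝ) z)
      (fun z => cdf (F θ₀ : Measure ℝ) z) atTop)
    -- the prior `DP(a, F_θ)` (to be used at `θ = θ(x)`) and the posterior `DP(a + n, H_x)`
    (a : ℝ) (ha : 0 < a)
    (prior : Θ → Measure (ProbabilityMeasure ℝ))
    (hprior : ∀ θ, ModelCheck.IsDirichletProcess a (F θ : Measure ℝ) (prior θ))
    (post : (n : ℕ) → (Fin n → ℝ) → Measure (ProbabilityMeasure ℝ))
    (hpost : ∀ (n : ℕ) (x : Fin n → ℝ), ModelCheck.IsDirichletProcess (a + n)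
      (ModelCheck.posteriorBase a (F (est n x) : Measure ℝ) x) (post n x))
    -- the discretization
    (M i₀ : ℕ) (hi₀ : 1 ≤ i₀) (hi₀M : i₀ < M) :
    let θ : ℕ → Ω → Θ := fun n ω => est n fun i => X i ω
    -- the relative belief ratio, given the first `n` observations, of a cell
    let RB : ℕ → Ω → Set ℝ → ℝ := fun n ω C =>
      ModelCheck.relBelief (prior (θ n ω)) (post n fun i => X i ω) (F (θ n ω)) C
    let C₀ : Θ → Set ℝ := fun t => ModelCheck.nullCell (prior t) (F t) M i₀
    let C : Θ → ℕ → Set ℝ := fun t i => ModelCheck.cell (prior t) (F t) M i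
    -- the strength given the first `n` observations
    let S : ℕ → Ω → ℝ := fun n ω =>
      ModelCheck.strength (prior (θ n ω)) (post n fun i => X i ω) (F (θ n ω)) M i₀
    -- (i) the model is correct
    ((∃ t, Ptrue = F t) →
      0 < ModelCheck.probD (prior θ₀) (F θ₀) (C₀ θ₀) ∧
      (∀ᵐ ω ∂ν, Tendsto (fun n => RB n ω (C₀ (θ n ω))) atTop
        (𝓝 (1 / ModelCheck.probD (prior θ₀) (F θ₀) (C₀ θ₀)))) ∧
      (∀ i, i₀ ≤ i → i < M →
        ∀ᵐ ω ∂ν, Tendsto (fun n => RB n ω (C (θ n ω) i)) atTop (𝓝 0)) ∧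
      (∀ᵐ ω ∂ν, Tendsto (fun n => S n ω) atTop (𝓝 1))) ∧
    -- (ii) the model is false, and further from the truth than the width of the first cell
    ((¬ ∃ t, Ptrue = F t) →
      ModelCheck.quantileD (prior θ₀) (F θ₀) (i₀ / M)
        < ModelCheck.cvm (Ptrue : Measure ℝ) (F θ₀ : Measure ℝ) →
      (∀ᵐ ω ∂ν, Tendsto (fun n => RB n ω (C₀ (θ n ω))) atTop (𝓝 0)) ∧
      (∀ᵐ ω ∂ν, Tendsto (fun n => S n ω) atTop (𝓝 0))) := by
  intro θ RB C₀ C S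
  have hM : (0 : ℕ) < i₀ := hi₀
  have hp := ModelCheck.natCast_div_mem_Ioo hM hi₀M
  have hpriorP : ∀ t, IsProbabilityMeasure (prior t) := fun t =>
    (hprior t).isProbabilityMeasure ha.le
  have hpostP : ∀ n x, IsProbabilityMeasure (post n x) := fun n x =>
    (hpost n x).isProbabilityMeasure (by positivity)
  -- This removes the randomness of the discretization: cells and prior masses at `θ(x)` are those
  -- at `θ₀`, and only posterior masses depend on the data.
  have hlaw : ∀ t, (prior t).map (fun P : ProbabilityMeasure ℝ => ModelCheck.cvm (P : Measure ℝ)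
      (F t : Measure ℝ)) = (prior θ₀).map (fun P : ProbabilityMeasure ℝ =>
        ModelCheck.cvm (P : Measure ℝ) (F θ₀ : Measure ℝ)) := fun t =>
    ModelCheck.map_cvm_eq (hF t) (hF θ₀) ha.le (hprior t) (hprior θ₀)
  have hprob : ∀ t A, MeasurableSet A →
      ModelCheck.probD (prior t) (F t) A = ModelCheck.probD (prior θ₀) (F θ₀) A := by
    intro t A hA
    rw [ModelCheck.probD_eq_map (hF t) hA, ModelCheck.probD_eq_map (hF θ₀) hA, hlaw]
  have hquant : ∀ t q, ModelCheck.quantileD (prior t) (F t) q =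
      ModelCheck.quantileD (prior θ₀) (F θ₀) q := by
    intro t q
    rw [ModelCheck.quantileD_eq_quantile (hF t), ModelCheck.quantileD_eq_quantile (hF θ₀), hlaw]
  have hC₀ : ∀ t, C₀ t = C₀ θ₀ := by
    intro t
    simp only [C₀, ModelCheck.nullCell, hquant t]
  have hC : ∀ t i, C t i = C θ₀ i := by
    intro t i
    simp only [C, ModelCheck.cell, hquant t]
  have hC₀pos : 0 < ModelCheck.probD (prior θ₀) (F θ₀) (C₀ θ₀) :=
    ModelCheck.probD_nullCell_pos (hprior θ₀) ha (hF θ₀) hM hi₀M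
  have hd : 0 < ModelCheck.quantileD (prior θ₀) (F θ₀) (i₀ / M) :=
    ModelCheck.quantileD_pos (hprior θ₀) ha (hF θ₀) hp.1 hp.2
  have hRB₀ : ∀ n ω, RB n ω (C₀ (θ n ω)) =
      ModelCheck.probD (post n fun i => X i ω) (F (θ n ω)) (C₀ θ₀) /
        ModelCheck.probD (prior θ₀) (F θ₀) (C₀ θ₀) := by
    intro n ω
    simp only [RB, ModelCheck.relBelief]
    rw [hC₀, hprob _ _ (ModelCheck.measurableSet_nullCell _ _)]
  have hRB : ∀ n ω i, RB n ω (C (θ n ω) i) =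
      ModelCheck.probD (post n fun i => X i ω) (F (θ n ω)) (C θ₀ i) /
        ModelCheck.probD (prior θ₀) (F θ₀) (C θ₀ i) := by
    intro n ω i
    simp only [RB, ModelCheck.relBelief]
    rw [hC, hprob _ _ (ModelCheck.measurableSet_cell _ _)]
  have hdev := ModelCheck.ae_tendsto_posterior_deviation hF hXindep hXlaw hest ha hpost
  -- Only `d ≥ 0` has to be far from the limit, since distances are nonnegative; this admits
  -- complements of cells, which contain negative numbers.
  have hvanish : ∀ᵐ ω ∂ν, ∀ (δ : ℝ) (A : Set ℝ), 0 < δ →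
      (∀ d ∈ A, 0 ≤ d → δ ≤ |d - ModelCheck.cvm (Ptrue : Measure ℝ) (F θ₀ : Measure ℝ)|) →
      Tendsto (fun n => ModelCheck.probD (post n fun i => X i ω) (F (θ n ω)) A) atTop (𝓝 0) := by
    filter_upwards [hdev] with ω hω δ A hδ hA
    have h0 := (ENNReal.tendsto_toReal ENNReal.zero_ne_top).comp (hω δ hδ)
    refine squeeze_zero (fun n => measureReal_nonneg) (fun n => ?_) h0
    exact measureReal_mono fun P hP => hA _ hP (ModelCheck.cvm_nonneg _ _)
  refine ⟨fun hH => ?_, fun _ hfar => ?_⟩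
  · have hcvm : ModelCheck.cvm (Ptrue : Measure ℝ) (F θ₀ : Measure ℝ) = 0 := by
      rw [hθ₀ hH]
      simp [ModelCheck.cvm]
    rw [hcvm] at hvanish
    have hnull : ∀ᵐ ω ∂ν, Tendsto (fun n =>
        ModelCheck.probD (post n fun i => X i ω) (F (θ n ω)) (C₀ θ₀)) atTop (𝓝 1) := by
      filter_upwards [hvanish] with ω hω
      have h1 := (hω _ (C₀ θ₀)ᶜ hd fun d hdC hd0 => by
        rw [sub_zero, abs_of_nonneg hd0]
        exact le_of_not_gt fun hlt => hdC ⟨hd0, hlt⟩).const_sub 1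
      rw [sub_zero] at h1
      refine h1.congr fun n => ?_
      have hm : MeasurableSet {P : ProbabilityMeasure ℝ |
          ModelCheck.cvm (P : Measure ℝ) (F (θ n ω) : Measure ℝ) ∈ C₀ θ₀} :=
        ModelCheck.measurable_cvm _ (hF _) (ModelCheck.measurableSet_nullCell _ _)
      have := probReal_compl_eq_one_sub (μ := post n fun i => X i ω) hm
      rw [ModelCheck.probD, ModelCheck.probD]
      change 1 - (post n fun i => X i ω).real {P : ProbabilityMeasure ℝ |
          ModelCheck.cvm (P : Measure ℝ) (F (θ n ω) : Measure ℝ) ∈ C₀ θ₀}ᶜ = _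
      rw [this, sub_sub_cancel]
    refine ⟨hC₀pos, ?_, fun i hi hiM => ?_, ?_⟩
    · filter_upwards [hnull] with ω hω
      simp_rw [hRB₀]
      exact hω.div_const _
    · filter_upwards [hvanish] with ω hω
      simp_rw [hRB]
      have hpi := ModelCheck.natCast_div_mem_Ioo (hM.trans_le hi) hiM
      have := hω _ (C θ₀ i) (ModelCheck.quantileD_pos (hprior θ₀) ha (hF θ₀) hpi.1 hpi.2)
        fun d hdC hd0 => by
          rw [sub_zero, abs_of_nonneg hd0]
          simp only [C, ModelCheck.cell] at hdC
          split_ifs at hdC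
          exacts [hdC.1, hdC]
      -- The denominator is constant and `0 / c = 0` for every `c`, so this also covers a cell of
      -- prior mass zero.
      simpa using this.div_const (ModelCheck.probD (prior θ₀) (F θ₀) (C θ₀ i))
    · filter_upwards [hnull] with ω hω
      refine tendsto_of_tendsto_of_tendsto_of_le_of_le hω tendsto_const_nhds (fun n => ?_)
        fun n => measureReal_le_one
      rw [← hC₀ (θ n ω)]
      exact ModelCheck.probD_nullCell_le_strength
  · have hnull : ∀ᵐ ω ∂ν, Tendsto (fun n =>
        ModelCheck.probD (post n fun i => X i ω) (F (θ n ω)) (C₀ θ₀)) atTop (𝓝 0) := by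
      filter_upwards [hvanish] with ω hω
      -- The separation is `d_CvM(P_true, F_θ₀) - d_{i₀/M}`.
      refine hω _ (C₀ θ₀) (sub_pos.2 hfar) fun d hdC _ => ?_
      have := hdC.2
      rw [abs_sub_comm]
      exact (by linarith : _ ≤ _ - d).trans (le_abs_self _)
    have hRBlim : ∀ᵐ ω ∂ν, Tendsto (fun n => RB n ω (C₀ (θ n ω))) atTop (𝓝 0) := by
      filter_upwards [hnull] with ω hω
      simp_rw [hRB₀]
      simpa using hω.div_const (ModelCheck.probD (prior θ₀) (F θ₀) (C₀ θ₀))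
    refine ⟨hRBlim, ?_⟩
    filter_upwards [hnull, hRBlim] with ω hω hωRB
    have hb := hω.add (hωRB.const_mul (M : ℝ))
    rw [mul_zero, add_zero] at hb
    refine squeeze_zero (fun n => measureReal_nonneg) (fun n => ?_) hb
    rw [← hC₀ (θ n ω)]
    exact ModelCheck.strength_le fun i hi => ModelCheck.cell_eq_empty_or_probD_pos
      (hprior _) ha (hF _) (hM.trans_le (Finset.mem_Ico.1 hi).1) (Finset.mem_Ico.1 hi).2
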